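/- **Conventions.** $C^*$-algebras are unital and $\otimes$ between them is the minimal tensor product. A compact quantum group (CQG) is a unital $C^*$-algebra $\mathcal A$ with a coassociative unital $*$-homomorphism $\Delta:\mathcal A\to\mathcal A\otimes\mathcal A$ such that the linear spans of $\Delta(\mathcal A)(1\otimes\mathcal A)$ and $\Delta(\mathcal A)(\mathcal A\otimes 1)$ are norm-dense in $\mathcal A\otimes\mathcal A$. For a finite set $X$, $C(X)$ is the algebra and $L^2(X)$ the Hilbert space of functions $X\to\mathbb C$, with basis $\{\chi_x\}_{x\in X}$ (orthonormal in $L^2(X)$). A linear map $\beta:L^2(X)\to L^2(X)\otimes\mathcal A$, $\beta(\chi_y)=\sum_x\chi_x\otimes u^x_y$, is a co-representation if $\Delta(u^x_y)=\sum_z u^x_z\otimes u^z_y$; it is unitary if $U=(u^x_y)$ is a unitary matrix over $\mathcal A$. Put $\overline\beta(\chi_y)=\sum_x\chi_x\otimes (u^x_y)^*$; $\beta$ is bi-unitary if $\beta$ and $\overline\beta$ are unitary. For $T\in B(L^2(X))$ put $Ad_\beta(T)=U(T\otimes 1)U^*$. A co-action of $(\mathcal A,\Delta)$ on $C(X)$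 is a $*$-homomorphism $\alpha:C(X)\to C(X)\otimes\mathcal A$ with $(\alpha\otimes id)\alpha=(id\otimes\Delta)\alpha$ such that the span of $\alpha(C(X))(1\otimes\mathcal A)$ is dense. Let $(V,E)$ be a finite multigraph (quiver) with source and target maps $s,t:E\to V$ and without isolated vertices. Put $V^s=s(E)$, $V^t=t(E)$, $\xi_0=\sum_{\tau\in E}\chi_\tau$, and let $p_\tau$ be the projection onto $\mathbb C\chi_\tau$. Put $S(\chi_v)=\sum_{s(\tau)=v}p_\tau$ and $T(\chi_w)=\sum_{t(\tau)=w}p_\tau$, extended linearly to $S:C(V^s)\to B(L^2(E))$ and $T:C(V^t)\to B(L^2(E))$. For $k,l\in V$ let $p_{kl}=\sum_{s(\tau)=k,\,t(\tau)=l}p_\tau$, let $D_{kl}$ be the span of the $p_\tau$ with $s(\tau)=k$, $t(\tau)=l$, and for $\gamma\in\{\beta,\overline\beta\}$ put $(Ad_\gamma)^{ij}_{kl}(x)=(p_{kl}\otimes1)Ad_\gamma(x)(p_{kl}\otimes 1)$. **Directed case.** $\beta$ is a *co-action of $(\mathcal A,\Delta)$ on $(V,E)$ preserving its quantum symmetry*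 if $\beta:L^2(E)\to L^2(E)\otimes\mathcal A$ is a bi-unitary co-representation such that 1. $Ad_\beta(S(C(V^s)))\subseteq S(C(V^s))\otimes\mathcal A$; 2. $Ad_{\overline\beta}(T(C(V^t)))\subseteq T(C(V^t))\otimes\mathcal A$; 3. the induced co-actions $\alpha_s$ on $C(V^s)$ and $\alpha_t$ on $C(V^t)$, i.e. the co-actions satisfying $\alpha_s(\chi_i)\beta(\chi_\tau)=\delta_{i,s(\tau)}\beta(\chi_\tau)$ and $\beta(\chi_\tau)\alpha_t(\chi_j)=\delta_{t(\tau),j}\beta(\chi_\tau)$ (where $\chi_v$ acts on $L^2(E)$ from the left by $\chi_v.\chi_\sigma=\delta_{v,s(\sigma)}\chi_\sigma$ and from the right by $\chi_\sigma.\chi_v=\delta_{t(\sigma),v}\chi_\sigma$), both preserve $C(V^s\cap V^t)$ and agree on it; 4. $\beta(\xi_0)=\xi_0\otimes 1$; 5. $(Ad_\beta)^{ij}_{kl}(D_{ij})\subseteq D_{kl}\otimes\mathcal A$ and $(Ad_{\overline\beta})^{ij}_{kl}(D_{ij})\subseteq D_{kl}\otimes\mathcal A$ whenever there are edges from $i$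 to $j$ and from $k$ to $l$. **Undirected case.** An undirected multigraph $(V,\mathcal E,j)$ is a multigraph with an involution $j$ of $\mathcal E$ which exchanges source and target and fixes every loop; let $J(\chi_\tau)=\chi_{j(\tau)}$. With $S$, $\xi_0$, $p_{kl}$, $D_{kl}$ formed for $\mathcal E$ (and $S$ defined on $C(V)$), $\beta_u$ is a *co-action of $(\mathcal A,\Delta)$ on $(V,\mathcal E,j)$ preserving its quantum symmetry* if $\beta_u:L^2(\mathcal E)\to L^2(\mathcal E)\otimes\mathcal A$ is a unitary co-representation such that $Ad_{\beta_u}(S(C(V)))\subseteq S(C(V))\otimes\mathcal A$, $\beta_u\circ J=(J\otimes id)\circ\overline{\beta_u}$, $\beta_u(\xi_0)=\xi_0\otimes1$, and $(Ad_{\beta_u})^{ij}_{kl}(D_{ij})\subseteq D_{kl}\otimes\mathcal A$ whenever there are edges in $\mathcal E$ from $i$ to $j$ and from $k$ to $l$. The *underlying undirected multigraph* $(V,\mathcal E,j)$ of $(V,E)$ is obtained by adding to $E$ a new edge $\overline\sigma$ from $t(\sigma)$ to $s(\sigma)$ for each non-loop $\sigma\in E$, with $j(\sigma)=\overline\sigma$,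 $j(\overline\sigma)=\sigma$, and $j(\tau)=\tau$ for loops; thus $L^2(E)\subseteq L^2(\mathcal E)$. **Theorem.** Let $(V,E)$ be a finite directed multigraph without isolated vertices, $(V,\mathcal E,j)$ its underlying undirected multigraph, and $(\mathcal A,\Delta)$ a CQG. (a) If $\beta$ is a co-action of $(\mathcal A,\Delta)$ on $(V,E)$ preserving its quantum symmetry, then there is a co-action $\beta_u$ of $(\mathcal A,\Delta)$ on $(V,\mathcal E,j)$ preserving its quantum symmetry such that $\beta_u(L^2(E))\subseteq L^2(E)\otimes\mathcal A$ and $\beta_u|_{L^2(E)}=\beta$. (b) Conversely, if $\beta_u$ is a co-action of $(\mathcal A,\Delta)$ on $(V,\mathcal E,j)$ preserving its quantum symmetry and $\beta_u(L^2(E))\subseteq L^2(E)\otimes\mathcal A$, then $\beta=\beta_u|_{L^2(E)}$ is a co-action of $(\mathcal A,\Delta)$ on $(V,E)$ preserving its quantum symmetry. -/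

import Mathlib

open scoped TensorProduct ENNReal

universe u

noncomputable section

/-! ## Hilbert space tensor products and the minimal tensor product of C*-algebras -/

/-- The Hilbert space tensor product of `H` and `K`: the completion of the algebraic tensor product
with inner product `⟪x ⊗ y, x' ⊗ y'⟫ = ⟪x, x'⟫ * ⟪y, y'⟫`. -/
abbrev HilbertTensor (H K : Type u) [NormedAddCommGroup H] [InnerProductSpace ℂ H]
    [NormedAddCommGroup K] [InnerProductSpace ℂ K] : Type u :=
  UniformSpace.Completion (H ⊗[ℂ] K)

namespace HilbertTensor

variable {H K : Type u} [NormedAddCommGroup H] [InnerProductSpace ℂ H]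
  [NormedAddCommGroup K] [InnerProductSpace ℂ K]

/-- The elementary tensor `x ⊗ y` in the Hilbert space tensor product. -/
def tmul (x : H) (y : K) : HilbertTensor H K :=
  ((x ⊗ₜ[ℂ] y : H ⊗[ℂ] K) : UniformSpace.Completion (H ⊗[ℂ] K))

instance [Nontrivial H] [Nontrivial K] : Nontrivial (HilbertTensor H K) := by
  obtain ⟨x, hx⟩ := exists_ne (0 : H)
  obtain ⟨y, hy⟩ := exists_ne (0 : K)
  refine ⟨tmul x y, 0, fun h => ?_⟩
  have h' : ‖tmul x y‖ = 0 := by rw [h, norm_zero]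
  rw [tmul, UniformSpace.Completion.norm_coe, TensorProduct.norm_tmul] at h'
  exact (mul_ne_zero (norm_ne_zero_iff.mpr hx) (norm_ne_zero_iff.mpr hy)) h'

/-- The bounded operator `S ⊗ T` on the Hilbert space tensor product. -/
def mapOp (S : H →L[ℂ] H) (T : K →L[ℂ] K) : HilbertTensor H K →L[ℂ] HilbertTensor H K :=
  (TensorProduct.mapL S T).completion

theorem norm_mapOp_le (S : H →L[ℂ] H) (T : K →L[ℂ] K) : ‖mapOp S T‖ ≤ ‖S‖ * ‖T‖ := by
  refine ContinuousLinearMap.opNorm_le_bound _ (by positivity) fun x => ?_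
  induction x using UniformSpace.Completion.induction_on with
  | hp => exact isClosed_le (by fun_prop) (by fun_prop)
  | ih x =>
    rw [mapOp, ContinuousLinearMap.completion_apply_coe, UniformSpace.Completion.norm_coe,
      UniformSpace.Completion.norm_coe]
    exact (ContinuousLinearMap.le_opNorm _ _).trans
      (mul_le_mul_of_nonneg_right (TensorProduct.norm_mapL_le S T) (norm_nonneg _))

end HilbertTensor

/-- A (unital) `*`-representation of a unital C*-algebra on a nonzero Hilbert space. -/
structure HilbertRep (A : Type u) [CStarAlgebra A] : Type (u + 1) where
  /-- The Hilbert space. -/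
  H : Type u
  [normed : NormedAddCommGroup H]
  [inner : InnerProductSpace ℂ H]
  [complete : CompleteSpace H]
  [nontrivial : Nontrivial H]
  /-- The representation. -/
  π : A →⋆ₐ[ℂ] (H →L[ℂ] H)

attribute [instance] HilbertRep.normed HilbertRep.inner HilbertRep.complete HilbertRep.nontrivial

/-- The C*-algebra of bounded operators on the tensor product of the Hilbert spaces of two
representations. -/
def RepTensorOp (A B : Type u) [CStarAlgebra A] [CStarAlgebra B]
    (p : HilbertRep A × HilbertRep B) : Type u :=
  HilbertTensor p.1.H p.2.H →L[ℂ] HilbertTensor p.1.H p.2.H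

instance (A B : Type u) [CStarAlgebra A] [CStarAlgebra B] (p : HilbertRep A × HilbertRep B) :
    CStarAlgebra (RepTensorOp A B p) :=
  inferInstanceAs
    (CStarAlgebra (HilbertTensor p.1.H p.2.H →L[ℂ] HilbertTensor p.1.H p.2.H))

instance (A B : Type u) [CStarAlgebra A] [CStarAlgebra B] (p : HilbertRep A × HilbertRep B) :
    NormOneClass (RepTensorOp A B p) :=
  inferInstanceAs
    (NormOneClass (HilbertTensor p.1.H p.2.H →L[ℂ] HilbertTensor p.1.H p.2.H))

/-- The C*-algebra of all bounded families `(x_{π,ρ})` of operators `x_{π,ρ}` on `H_π ⊗ H_ρ`, where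
`π`, `ρ` run over all representations of `A`, `B`, with the supremum norm. -/
abbrev RepTensorFamily (A B : Type u) [CStarAlgebra A] [CStarAlgebra B] : Type (u + 1) :=
  lp (RepTensorOp A B) ∞

instance (A B : Type u) [CStarAlgebra A] [CStarAlgebra B] :
    CStarAlgebra (RepTensorFamily A B) where

/-- The family `(π(a) ⊗ ρ(b))_{π,ρ}`. -/
def RepTensorFamily.tmul {A B : Type u} [CStarAlgebra A] [CStarAlgebra B] (a : A) (b : B) :
    RepTensorFamily A B :=
  ⟨fun p => HilbertTensor.mapOp (p.1.π a) (p.2.π b), by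
    refine memℓp_infty ⟨‖a‖ * ‖b‖, ?_⟩
    rintro _ ⟨p, rfl⟩
    refine (HilbertTensor.norm_mapOp_le _ _).trans ?_
    exact mul_le_mul (NonUnitalStarAlgHom.norm_apply_le p.1.π a)
      (NonUnitalStarAlgHom.norm_apply_le p.2.π b) (norm_nonneg _) (norm_nonneg _)⟩

/-- The minimal (spatial) tensor product `A ⊗ B` of two unital C*-algebras: the completion of the
algebraic tensor product for the norm `‖x‖ = sup_{π,ρ} ‖(π ⊗ ρ)(x)‖`, realised as the closed
`*`-subalgebra generated by the elements `a ⊗ b = (π(a) ⊗ ρ(b))_{π,ρ}`. -/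
def minTensor (A B : Type u) [CStarAlgebra A] [CStarAlgebra B] :
    StarSubalgebra ℂ (RepTensorFamily A B) :=
  (StarAlgebra.adjoin ℂ
    (Set.range fun p : A × B => RepTensorFamily.tmul p.1 p.2)).topologicalClosure

instance (A B : Type u) [CStarAlgebra A] [CStarAlgebra B] :
    IsClosed (minTensor A B : Set (RepTensorFamily A B)) :=
  StarSubalgebra.isClosed_topologicalClosure _

/-- The minimal tensor product as a type. -/
def MinTensor (A B : Type u) [CStarAlgebra A] [CStarAlgebra B] : Type (u + 1) :=
  minTensor A B

instance (A B : Type u) [CStarAlgebra A] [CStarAlgebra B] : CStarAlgebra (MinTensor A B) :=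
  inferInstanceAs (CStarAlgebra (minTensor A B))

namespace MinTensor

variable {A B : Type u} [CStarAlgebra A] [CStarAlgebra B]

/-- The elementary tensor `a ⊗ b` in the minimal tensor product. -/
def tmul (a : A) (b : B) : MinTensor A B :=
  ⟨RepTensorFamily.tmul a b,
    StarSubalgebra.le_topologicalClosure _ (StarAlgebra.subset_adjoin ℂ _ ⟨(a, b), rfl⟩)⟩

/-- The representation `π ⊗ ρ` of `A ⊗ B` on `H_π ⊗ H_ρ`, determined by
`(π ⊗ ρ)(a ⊗ b) = π(a) ⊗ ρ(b)`. -/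
def rep (π : HilbertRep A) (ρ : HilbertRep B) :
    MinTensor A B →⋆ₐ[ℂ] (HilbertTensor π.H ρ.H →L[ℂ] HilbertTensor π.H ρ.H) where
  toFun x := x.1 (π, ρ)
  map_one' := rfl
  map_mul' _ _ := rfl
  map_zero' := rfl
  map_add' _ _ := rfl
  commutes' _ := rfl
  map_star' _ := rfl

theorem rep_tmul (π : HilbertRep A) (ρ : HilbertRep B) (a : A) (b : B) :
    rep π ρ (tmul a b) = HilbertTensor.mapOp (π.π a) (ρ.π b) := rfl

end MinTensor

/-! ## Compact quantum groups -/

/-- For a `*`-homomorphism `Δ : A → A ⊗ A`, the representation `(π ⊗ ρ) ∘ Δ` of `A`. -/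
def HilbertRep.comul {A : Type u} [CStarAlgebra A] (Δ : A →⋆ₐ[ℂ] MinTensor A A)
    (π ρ : HilbertRep A) : HilbertRep A where
  H := HilbertTensor π.H ρ.H
  π := (MinTensor.rep π ρ).comp Δ

/-- The operator `((π₁ ⊗ π₂) ⊗ π₃)((Δ ⊗ id)(x))` on `(H₁ ⊗ H₂) ⊗ H₃`. For `x = a ⊗ b` it is
`(π₁ ⊗ π₂)(Δ(a)) ⊗ π₃(b)`. -/
def comulLeft {A : Type u} [CStarAlgebra A] (Δ : A →⋆ₐ[ℂ] MinTensor A A)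
    (π₁ π₂ π₃ : HilbertRep A) (x : MinTensor A A) :
    HilbertTensor (HilbertTensor π₁.H π₂.H) π₃.H →L[ℂ]
      HilbertTensor (HilbertTensor π₁.H π₂.H) π₃.H :=
  MinTensor.rep (HilbertRep.comul Δ π₁ π₂) π₃ x

/-- The operator `(π₁ ⊗ (π₂ ⊗ π₃))((id ⊗ Δ)(x))` on `H₁ ⊗ (H₂ ⊗ H₃)`. For `x = a ⊗ b` it is
`π₁(a) ⊗ (π₂ ⊗ π₃)(Δ(b))`. -/
def comulRight {A : Type u} [CStarAlgebra A] (Δ : A →⋆ₐ[ℂ] MinTensor A A)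
    (π₁ π₂ π₃ : HilbertRep A) (x : MinTensor A A) :
    HilbertTensor π₁.H (HilbertTensor π₂.H π₃.H) →L[ℂ]
      HilbertTensor π₁.H (HilbertTensor π₂.H π₃.H) :=
  MinTensor.rep π₁ (HilbertRep.comul Δ π₂ π₃) x

theorem comulLeft_tmul {A : Type u} [CStarAlgebra A] (Δ : A →⋆ₐ[ℂ] MinTensor A A)
    (π₁ π₂ π₃ : HilbertRep A) (a b : A) :
    comulLeft Δ π₁ π₂ π₃ (MinTensor.tmul a b) =
      HilbertTensor.mapOp (MinTensor.rep π₁ π₂ (Δ a)) (π₃.π b) := rfl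

theorem comulRight_tmul {A : Type u} [CStarAlgebra A] (Δ : A →⋆ₐ[ℂ] MinTensor A A)
    (π₁ π₂ π₃ : HilbertRep A) (a b : A) :
    comulRight Δ π₁ π₂ π₃ (MinTensor.tmul a b) =
      HilbertTensor.mapOp (π₁.π a) (MinTensor.rep π₂ π₃ (Δ b)) := rfl

/-- A compact quantum group structure on a unital C*-algebra `A`: a `*`-homomorphism
`Δ : A → A ⊗ A` into the minimal tensor product which is coassociative and for which the linear
spans of `Δ(A)(1 ⊗ A)` and `Δ(A)(A ⊗ 1)` are norm-dense in `A ⊗ A`.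

The C*-algebra `A ⊗ A ⊗ A` is faithfully represented by the representations `π₁ ⊗ π₂ ⊗ π₃`, so
`(Δ ⊗ id)Δ(a) = (id ⊗ Δ)Δ(a)` means that for all `π₁, π₂, π₃` both sides give the same operator on
`(H₁ ⊗ H₂) ⊗ H₃ = H₁ ⊗ (H₂ ⊗ H₃)`, that is, the same matrix coefficients at elementary tensors. -/
structure CompactQuantumGroup (A : Type u) [CStarAlgebra A] where
  /-- The coproduct. -/
  comul : A →⋆ₐ[ℂ] MinTensor A A
  coassoc : ∀ (a : A) (π₁ π₂ π₃ : HilbertRep A) (x₁ y₁ : π₁.H) (x₂ y₂ : π₂.H) (x₃ y₃ : π₃.H),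
    inner ℂ (HilbertTensor.tmul (HilbertTensor.tmul x₁ x₂) x₃)
        (comulLeft comul π₁ π₂ π₃ (comul a)
          (HilbertTensor.tmul (HilbertTensor.tmul y₁ y₂) y₃)) =
      inner ℂ (HilbertTensor.tmul x₁ (HilbertTensor.tmul x₂ x₃))
        (comulRight comul π₁ π₂ π₃ (comul a)
          (HilbertTensor.tmul y₁ (HilbertTensor.tmul y₂ y₃)))
  dense_left : Dense (Submodule.span ℂ
    {x : MinTensor A A | ∃ a b : A, x = comul a * MinTensor.tmul 1 b} : Set (MinTensor A A))
  dense_right : Dense (Submodule.span ℂ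
    {x : MinTensor A A | ∃ a b : A, x = comul a * MinTensor.tmul b 1} : Set (MinTensor A A))

/-! ## Co-representations and co-actions on finite sets

For a finite set `X`, both the algebra `C(X)` and the Hilbert space `L²(X)` have `X → ℂ` as
underlying vector space, with basis `χ_x = Pi.single x 1` (orthonormal in `L²(X)`). Accordingly
`C(X) ⊗ A` and `L²(X) ⊗ A` are `X → A`, the element `f ⊗ a` being `x ↦ f(x) a`; `B(L²(X))` is
`Matrix X X ℂ` and `B(L²(X)) ⊗ A` is `Matrix X X A`, the element `T ⊗ a` being `(T_{xy} a)_{x,y}`. -/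

section FiniteSets

variable {A : Type u} [CStarAlgebra A] {X : Type*} [Fintype X] [DecidableEq X]

/-- The matrix `U = (u^x_y)` of a linear map `β : L²(X) → L²(X) ⊗ A`, given by
`β(χ_y) = ∑ x, χ_x ⊗ u^x_y`. -/
def corepMatrix (β : (X → ℂ) →ₗ[ℂ] (X → A)) : Matrix X X A :=
  Matrix.of fun x y => β (Pi.single y 1) x

/-- `β` is a co-representation: `Δ(u^x_y) = ∑ z, u^x_z ⊗ u^z_y`. -/
def IsCorepresentation (Q : CompactQuantumGroup A) (β : (X → ℂ) →ₗ[ℂ] (X → A)) : Prop :=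
  ∀ x y, Q.comul (corepMatrix β x y) =
    ∑ z, MinTensor.tmul (corepMatrix β x z) (corepMatrix β z y)

/-- The adjoint `β̄` of `β`, with `β̄(χ_y) = ∑ x, χ_x ⊗ (u^x_y)*`. -/
def adjointCorep (β : (X → ℂ) →ₗ[ℂ] (X → A)) : (X → ℂ) →ₗ[ℂ] (X → A) where
  toFun f x := ∑ y, f y • star (corepMatrix β x y)
  map_add' f g := by
    funext x
    simp [add_smul, Finset.sum_add_distrib]
  map_smul' c f := by
    funext x
    simp [mul_smul, Finset.smul_sum]

/-- `β` is unitary: its matrix is unitary, `U U* = U* U = 1`. -/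
def IsUnitaryCorep (β : (X → ℂ) →ₗ[ℂ] (X → A)) : Prop :=
  corepMatrix β ∈ unitary (Matrix X X A)

/-- A co-action `α : C(X) → C(X) ⊗ A` of a compact quantum group on the C*-algebra `C(X)`. -/
structure IsCoaction (Q : CompactQuantumGroup A) (α : (X → ℂ) →⋆ₐ[ℂ] (X → A)) : Prop where
  /-- `(α ⊗ id) α = (id ⊗ Δ) α` as maps `C(X) → C(X) ⊗ A ⊗ A`. -/
  coassoc : ∀ (f : X → ℂ) (x : X),
    ∑ y, MinTensor.tmul (α (Pi.single y 1) x) (α f y) = Q.comul (α f x)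
  /-- The linear span of `α(C(X)) (1 ⊗ A)` is dense in `C(X) ⊗ A`. -/
  dense : Dense (Submodule.span ℂ
    {F : X → A | ∃ (f : X → ℂ) (a : A), F = fun x => α f x * a} : Set (X → A))

/-- `T ⊗ 1 ∈ B(L²(X)) ⊗ A` for `T ∈ B(L²(X))`. -/
def tensorOne (A : Type u) [CStarAlgebra A] (T : Matrix X X ℂ) : Matrix X X A :=
  T.map (algebraMap ℂ A)

/-- `Ad_β(T) = U (T ⊗ 1) U*`. -/
def Ad (β : (X → ℂ) →ₗ[ℂ] (X → A)) (T : Matrix X X ℂ) : Matrix X X A :=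
  corepMatrix β * tensorOne A T * (corepMatrix β).conjTranspose

/-- The subspace `W ⊗ A` of `B(L²(X)) ⊗ A`, for a linear subspace `W` of `B(L²(X))`. -/
def tensorSubspace (W : Submodule ℂ (Matrix X X ℂ)) (A : Type u) [CStarAlgebra A] :
    Submodule ℂ (Matrix X X A) :=
  Submodule.span ℂ {M | ∃ T ∈ W, ∃ a : A, M = Matrix.of fun x y => T x y • a}

end FiniteSets

/-! ## Multigraphs -/

/-- A (directed) multigraph, i.e. quiver, with vertex set `V`, edge set `E`, source map `s` and
target map `t`. -/
structure Multigraph (V E : Type*) where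
  /-- The source map. -/
  s : E → V
  /-- The target map. -/
  t : E → V

/-- An undirected multigraph: a multigraph with an inversion map `j`. (Its adjacency matrix is
symmetric because `j` exchanges the edges from `k` to `l` with those from `l` to `k`.) -/
structure UndirectedMultigraph (V E : Type*) extends Multigraph V E where
  /-- The inversion map. -/
  j : E → E
  j_j : ∀ τ, j (j τ) = τ
  j_loop : ∀ τ, s τ = t τ → j τ = τ
  s_j : ∀ τ, s (j τ) = t τ
  t_j : ∀ τ, t (j τ) = s τ

namespace Multigraph

variable {V E : Type*} (G : Multigraph V E)

/-- Every vertex is the source or the target of some edge. -/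
def NoIsolatedVertex : Prop :=
  ∀ v, (∃ τ, G.s τ = v) ∨ ∃ τ, G.t τ = v

/-- The set `V^s = s(E)`. -/
abbrev Vs : Set V := Set.range G.s

/-- The set `V^t = t(E)`. -/
abbrev Vt : Set V := Set.range G.t

/-- The source of an edge as an element of `V^s`. -/
def src (τ : E) : G.Vs := ⟨G.s τ, τ, rfl⟩

/-- The target of an edge as an element of `V^t`. -/
def tgt (τ : E) : G.Vt := ⟨G.t τ, τ, rfl⟩

section Operators

variable [DecidableEq E]

/-- `S : C(V^s) → B(L²(E))`, `S(χ_v) = ∑_{s(τ) = v} p_τ`. -/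
def S : (G.Vs → ℂ) →ₗ[ℂ] Matrix E E ℂ :=
  Matrix.diagonalLinearMap E ℂ ℂ ∘ₗ LinearMap.funLeft ℂ ℂ G.src

/-- `T : C(V^t) → B(L²(E))`, `T(χ_w) = ∑_{t(τ) = w} p_τ`. -/
def T : (G.Vt → ℂ) →ₗ[ℂ] Matrix E E ℂ :=
  Matrix.diagonalLinearMap E ℂ ℂ ∘ₗ LinearMap.funLeft ℂ ℂ G.tgt

variable [Fintype E] [DecidableEq V]

/-- `p_{kl}`, the orthogonal projection onto the span of the `χ_τ` with `τ` an edge from `k` to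
`l`. -/
def edgeProj (k l : V) : Matrix E E ℂ :=
  Matrix.diagonal fun τ => if G.s τ = k ∧ G.t τ = l then 1 else 0

/-- `D_{kl} = p_{kl} D p_{kl}`, where `D` is the algebra of diagonal operators. -/
def diagBlock (k l : V) : Submodule ℂ (Matrix E E ℂ) :=
  (LinearMap.range (Matrix.diagonalLinearMap E ℂ ℂ)).map
    (LinearMap.mulLeft ℂ (G.edgeProj k l) ∘ₗ LinearMap.mulRight ℂ (G.edgeProj k l))

/-- `(Ad_β)^{ij}_{kl}(D_{ij}) ⊆ D_{kl} ⊗ A` for all `i, j, k, l` such that there are edges from `i`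
to `j` and from `k` to `l`, where `(Ad_β)^{ij}_{kl}(x) = (p_{kl} ⊗ 1) Ad_β(x) (p_{kl} ⊗ 1)`. -/
def RestrictedOrthogonality {A : Type u} [CStarAlgebra A] (β : (E → ℂ) →ₗ[ℂ] (E → A)) : Prop :=
  ∀ i j k l : V, (∃ τ, G.s τ = i ∧ G.t τ = j) → (∃ τ, G.s τ = k ∧ G.t τ = l) →
    ∀ x ∈ G.diagBlock i j,
      tensorOne A (G.edgeProj k l) * Ad β x * tensorOne A (G.edgeProj k l) ∈
        tensorSubspace (G.diagBlock k l) A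

end Operators

section Directed

variable {A : Type u} [CStarAlgebra A] (Q : CompactQuantumGroup A)
  [Fintype E] [DecidableEq E] [DecidableEq V]

/-- `αs` is the co-action on `C(V^s)` induced by `β`:
`αs(χ_i) β(χ_τ) = β(χ_i . χ_τ)`, where `χ_i . χ_τ = δ_{i, s(τ)} χ_τ`. -/
def IsInducedSource (β : (E → ℂ) →ₗ[ℂ] (E → A)) (αs : (G.Vs → ℂ) →⋆ₐ[ℂ] (G.Vs → A)) : Prop :=
  IsCoaction Q αs ∧ ∀ (i : G.Vs) (τ σ : E),
    αs (Pi.single i 1) (G.src σ) * β (Pi.single τ 1) σ =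
      β (if i = G.src τ then Pi.single τ 1 else 0) σ

/-- `αt` is the co-action on `C(V^t)` induced by `β`:
`β(χ_τ) αt(χ_j) = β(χ_τ . χ_j)`, where `χ_τ . χ_j = δ_{t(τ), j} χ_τ`. -/
def IsInducedTarget (β : (E → ℂ) →ₗ[ℂ] (E → A)) (αt : (G.Vt → ℂ) →⋆ₐ[ℂ] (G.Vt → A)) : Prop :=
  IsCoaction Q αt ∧ ∀ (j : G.Vt) (τ σ : E),
    β (Pi.single τ 1) σ * αt (Pi.single j 1) (G.tgt σ) =
      β (if G.tgt τ = j then Pi.single τ 1 else 0) σ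

/-- `β : L²(E) → L²(E) ⊗ A` is a co-action of the compact quantum group on the directed multigraph
`(V, E)` preserving its quantum symmetry. -/
structure PreservesQuantumSymmetry (β : (E → ℂ) →ₗ[ℂ] (E → A)) : Prop where
  corep : IsCorepresentation Q β
  unitary : IsUnitaryCorep β
  unitary_adjoint : IsUnitaryCorep (adjointCorep β)
  /-- `Ad_β(S(C(V^s))) ⊆ S(C(V^s)) ⊗ A`. -/
  source : ∀ f, Ad β (G.S f) ∈ tensorSubspace (LinearMap.range G.S) A
  /-- `Ad_β̄(T(C(V^t))) ⊆ T(C(V^t)) ⊗ A`. -/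
  target : ∀ f, Ad (adjointCorep β) (G.T f) ∈ tensorSubspace (LinearMap.range G.T) A
  /-- The induced co-actions `αs` on `C(V^s)` and `αt` on `C(V^t)` preserve `C(V^s ∩ V^t)` and agree
  on it. -/
  induced : ∃ (αs : (G.Vs → ℂ) →⋆ₐ[ℂ] (G.Vs → A)) (αt : (G.Vt → ℂ) →⋆ₐ[ℂ] (G.Vt → A)),
    G.IsInducedSource Q β αs ∧ G.IsInducedTarget Q β αt ∧
    (∀ f : G.Vs → ℂ, (∀ v : G.Vs, (v : V) ∉ G.Vt → f v = 0) →
      ∀ v : G.Vs, (v : V) ∉ G.Vt → αs f v = 0) ∧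
    (∀ f : G.Vt → ℂ, (∀ v : G.Vt, (v : V) ∉ G.Vs → f v = 0) →
      ∀ v : G.Vt, (v : V) ∉ G.Vs → αt f v = 0) ∧
    (∀ (k v : V) (hks : k ∈ G.Vs) (hkt : k ∈ G.Vt) (hvs : v ∈ G.Vs) (hvt : v ∈ G.Vt),
      αs (Pi.single ⟨k, hks⟩ 1) ⟨v, hvs⟩ = αt (Pi.single ⟨k, hkt⟩ 1) ⟨v, hvt⟩)
  /-- `β(ξ₀) = ξ₀ ⊗ 1` for `ξ₀ = ∑ τ, χ_τ`. -/
  fixed : β (fun _ => 1) = fun _ => 1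
  ortho : G.RestrictedOrthogonality β
  ortho_adjoint : G.RestrictedOrthogonality (adjointCorep β)

end Directed

end Multigraph

namespace UndirectedMultigraph

variable {V E : Type*} (G : UndirectedMultigraph V E)

/-- `J : L²(E) → L²(E)`, `J(χ_τ) = χ_{j(τ)}`; the same formula gives `J ⊗ id` on `L²(E) ⊗ A`.
(Since `j` is an involution, `J(f) = f ∘ j`.) -/
def J (B : Type*) [AddCommMonoid B] [Module ℂ B] : (E → B) →ₗ[ℂ] (E → B) :=
  LinearMap.funLeft ℂ B G.j

/-- `S : C(V) → B(L²(E))`, `S(χ_v) = ∑_{s(τ) = v} p_τ`. -/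
def S [DecidableEq E] : (V → ℂ) →ₗ[ℂ] Matrix E E ℂ :=
  Matrix.diagonalLinearMap E ℂ ℂ ∘ₗ LinearMap.funLeft ℂ ℂ G.s

/-- `β : L²(E) → L²(E) ⊗ A` is a co-action of the compact quantum group on the undirected multigraph
`(V, E, j)` preserving its quantum symmetry. -/
structure PreservesQuantumSymmetry {A : Type u} [CStarAlgebra A] (Q : CompactQuantumGroup A)
    [Fintype E] [DecidableEq E] [DecidableEq V] (β : (E → ℂ) →ₗ[ℂ] (E → A)) : Prop where
  corep : IsCorepresentation Q β
  unitary : IsUnitaryCorep β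
  /-- `Ad_β(S(C(V))) ⊆ S(C(V)) ⊗ A`. -/
  source : ∀ f, Ad β (G.S f) ∈ tensorSubspace (LinearMap.range G.S) A
  /-- `β ∘ J = (J ⊗ id) ∘ β̄`. -/
  inversion : β ∘ₗ G.J ℂ = G.J A ∘ₗ adjointCorep β
  /-- `β(ξ₀) = ξ₀ ⊗ 1` for `ξ₀ = ∑ τ, χ_τ`. -/
  fixed : β (fun _ => 1) = fun _ => 1
  ortho : G.toMultigraph.RestrictedOrthogonality β

end UndirectedMultigraph

/-! ## The underlying undirected multigraph -/

namespace Multigraph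

variable {V E : Type*} (G : Multigraph V E)

/-- The edge set of the underlying undirected multigraph: all edges of `G`, together with a new
reversed edge for every edge of `G` that is not a loop. -/
abbrev UndirectedEdge : Type _ := E ⊕ {τ : E // G.s τ ≠ G.t τ}

/-- The underlying undirected multigraph of a directed multigraph. -/
def underlying [DecidableEq V] : UndirectedMultigraph V G.UndirectedEdge where
  s := Sum.elim G.s fun τ => G.t τ
  t := Sum.elim G.t fun τ => G.s τ
  j := Sum.elim (fun τ => if h : G.s τ ≠ G.t τ then Sum.inr ⟨τ, h⟩ else Sum.inl τ)
    fun τ => Sum.inl τ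
  j_j := by
    rintro (τ | ⟨τ, h⟩)
    · by_cases h : G.s τ = G.t τ <;> simp [h]
    · simp [h]
  j_loop := by
    rintro (τ | ⟨τ, h⟩) h'
    · simpa using h'
    · exact absurd h'.symm h
  s_j := by
    rintro (τ | ⟨τ, h⟩)
    · by_cases h : G.s τ = G.t τ <;> simp [h]
    · simp
  t_j := by
    rintro (τ | ⟨τ, h⟩)
    · by_cases h : G.s τ = G.t τ <;> simp [h]
    · simp

variable {A : Type u} [CStarAlgebra A]

/-- `γ(L²(E)) ⊆ L²(E) ⊗ A`, where `L²(E)` is the space of functions on the edges of the underlying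
undirected multigraph that vanish on all new edges. -/
def LeavesInvariant (γ : (G.UndirectedEdge → ℂ) →ₗ[ℂ] (G.UndirectedEdge → A)) : Prop :=
  ∀ f : G.UndirectedEdge → ℂ, (∀ τ, f (Sum.inr τ) = 0) → ∀ σ, γ f (Sum.inr σ) = 0

/-- The restriction `γ|_{L²(E)} : L²(E) → L²(E) ⊗ A` (for `γ` leaving `L²(E)` invariant). -/
def restrictL2 (γ : (G.UndirectedEdge → ℂ) →ₗ[ℂ] (G.UndirectedEdge → A)) :
    (E → ℂ) →ₗ[ℂ] (E → A) where
  toFun f σ := γ (Sum.elim f fun _ => 0) (Sum.inl σ)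
  map_add' f g := by
    have h : (Sum.elim (f + g) fun _ => 0 : G.UndirectedEdge → ℂ) =
        (Sum.elim f fun _ => 0) + Sum.elim g fun _ => 0 := by
      funext x
      rcases x with x | x <;> simp
    funext σ
    rw [h, map_add]
    rfl
  map_smul' c f := by
    have h : (Sum.elim (c • f) fun _ => 0 : G.UndirectedEdge → ℂ) =
        c • (Sum.elim f fun _ => 0) := by
      funext x
      rcases x with x | x <;> simp
    funext σ
    rw [h, map_smul]
    rfl

end Multigraph

end

noncomputable section

/-! ## Elementary tensors -/

namespace HilbertTensor

variable {H K : Type u} [NormedAddCommGroup H] [InnerProductSpace ℂ H]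
  [NormedAddCommGroup K] [InnerProductSpace ℂ K]

/-! Everything is read off the matrix `u` of the co-action. Source invariance means that there are
elements `q k i` of `A` with `q (s σ) i * u σ τ = δ_{i, s τ} u σ τ`; target invariance gives
elements `r` in the same relation to the entrywise adjoint of `u` and to `t`. This situation,
together with unitarity and row sums `1`, is `IsGraded`.

The heart of the proof is that such a `q` is a magic unitary. Its rows consist of orthogonal
projections with sum `1` by direct computation. For the columns, let `m k` be the size of the fibre
over `k`. Unitarity gives `∑ k, m k • q k i = m i • 1`, and positivity then forces `m k = m i`
whenever `q k i ≠ 0` (`card_eq_of_ne_zero`), so the columns are orthogonal and sum to `1`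
(`mul_col`, `col_sum_eq_one`). Only counting and positivity are used, no Haar state.

Restricted orthogonality says that `u σ τ * star (u σ' τ) = 0` for distinct parallel `σ`, `σ'`. With
the two gradings it yields `q * r * star (u σ τ) = u σ τ * star (u σ τ)`, with `q`, `r` taken at the
sources and targets of `σ`, `τ` (`mul_star_self_eq`). Hence `u σ τ` vanishes as soon as the product
`q * r` does.

For (a), `q` and `r` agree on the common vertices. If exactly one of `σ`, `τ` is a loop, then `q * r
= 0` by orthogonality in a row or a column, so `u σ τ = 0`; if both are loops, `u σ τ` is
self-adjoint. So the block matrix with `u` on old edges and its conjugate on reversed non-loops is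
unitary and compatible with `j`.

For (b), compatibility with `j` makes the conjugate matrix graded by targets with the same `q`.
Invariance of `L²(E)`, reversal and the vanishing criterion make the matrix block diagonal, and both
induced co-actions are blocks of the single matrix `q`. -/

theorem mapOp_coe (S : H →L[ℂ] H) (T : K →L[ℂ] K) (x : H ⊗[ℂ] K) :
    mapOp S T (x : UniformSpace.Completion (H ⊗[ℂ] K)) =
      ((TensorProduct.mapL S T x : H ⊗[ℂ] K) : UniformSpace.Completion (H ⊗[ℂ] K)) := by
  rw [mapOp, ContinuousLinearMap.completion_apply_coe]

theorem ext_coe {S T : HilbertTensor H K →L[ℂ] HilbertTensor H K}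
    (h : ∀ x : H ⊗[ℂ] K, S (x : UniformSpace.Completion (H ⊗[ℂ] K)) =
      T (x : UniformSpace.Completion (H ⊗[ℂ] K))) : S = T := by
  ext x
  induction x using UniformSpace.Completion.induction_on with
  | hp => exact isClosed_eq (by fun_prop) (by fun_prop)
  | ih x => exact h x

theorem mapOp_add_left (S S' : H →L[ℂ] H) (T : K →L[ℂ] K) :
    mapOp (S + S') T = mapOp S T + mapOp S' T :=
  ext_coe fun x => by
    simp [mapOp_coe, TensorProduct.mapL_add_left, UniformSpace.Completion.coe_add]

theorem mapOp_add_right (S : H →L[ℂ] H) (T T' : K →L[ℂ] K) :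
    mapOp S (T + T') = mapOp S T + mapOp S T' :=
  ext_coe fun x => by
    simp [mapOp_coe, TensorProduct.mapL_add_right, UniformSpace.Completion.coe_add]

theorem mapOp_smul_left (c : ℂ) (S : H →L[ℂ] H) (T : K →L[ℂ] K) :
    mapOp (c • S) T = c • mapOp S T :=
  ext_coe fun x => by simp [mapOp_coe, TensorProduct.mapL_smul_left]

theorem mapOp_smul_right (c : ℂ) (S : H →L[ℂ] H) (T : K →L[ℂ] K) :
    mapOp S (c • T) = c • mapOp S T :=
  ext_coe fun x => by simp [mapOp_coe, TensorProduct.mapL_smul_right]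

theorem inner_mapL_star [CompleteSpace H] [CompleteSpace K] (S : H →L[ℂ] H) (T : K →L[ℂ] K)
    (x y : H ⊗[ℂ] K) :
    inner ℂ (TensorProduct.mapL (star S) (star T) x) y =
      inner ℂ x (TensorProduct.mapL S T y) := by
  induction x with
  | zero => simp
  | add x x' hx hx' => rw [map_add, inner_add_left, inner_add_left, hx, hx']
  | tmul a b =>
    induction y with
    | zero => simp
    | add y y' hy hy' => rw [map_add, inner_add_right, inner_add_right, hy, hy']
    | tmul c d =>
      simp [TensorProduct.inner_tmul, ContinuousLinearMap.star_eq_adjoint,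
        ContinuousLinearMap.adjoint_inner_left]

theorem star_mapOp [CompleteSpace H] [CompleteSpace K] (S : H →L[ℂ] H) (T : K →L[ℂ] K) :
    star (mapOp S T) = mapOp (star S) (star T) := by
  rw [ContinuousLinearMap.star_eq_adjoint, eq_comm, ContinuousLinearMap.eq_adjoint_iff]
  intro x y
  induction x, y using UniformSpace.Completion.induction_on₂ with
  | hp => exact isClosed_eq (by fun_prop) (by fun_prop)
  | ih x y =>
    rw [mapOp_coe, mapOp_coe, UniformSpace.Completion.inner_coe,
      UniformSpace.Completion.inner_coe, inner_mapL_star]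

end HilbertTensor

namespace MinTensor

variable {A B : Type u} [CStarAlgebra A] [CStarAlgebra B]

/-- Elements of the minimal tensor product are by construction families indexed by pairs of
representations, so identities can be tested on operators. -/
theorem ext_rep {x y : MinTensor A B} (h : ∀ π ρ, rep π ρ x = rep π ρ y) : x = y :=
  Subtype.ext (lp.ext (funext fun p => h p.1 p.2))

/-- The elementary tensor as a bilinear map. -/
def tmulₗ : A →ₗ[ℂ] B →ₗ[ℂ] MinTensor A B :=
  LinearMap.mk₂ ℂ tmul
    (fun a a' b => ext_rep fun π ρ => by
      simp only [map_add, rep_tmul, HilbertTensor.mapOp_add_left])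
    (fun c a b => ext_rep fun π ρ => by
      simp only [map_smul, rep_tmul, HilbertTensor.mapOp_smul_left])
    (fun a b b' => ext_rep fun π ρ => by
      simp only [map_add, rep_tmul, HilbertTensor.mapOp_add_right])
    (fun c a b => ext_rep fun π ρ => by
      simp only [map_smul, rep_tmul, HilbertTensor.mapOp_smul_right])

theorem tmulₗ_apply (a : A) (b : B) : tmulₗ a b = tmul a b := rfl

theorem zero_tmul (b : B) : tmul (0 : A) b = 0 := by simp [← tmulₗ_apply]

theorem tmul_zero (a : A) : tmul a (0 : B) = 0 := by simp [← tmulₗ_apply]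

theorem tmul_smul (c : ℂ) (a : A) (b : B) : tmul a (c • b) = c • tmul a b := by
  simp [← tmulₗ_apply]

theorem sum_tmul {ι : Type*} (s : Finset ι) (f : ι → A) (b : B) :
    tmul (∑ i ∈ s, f i) b = ∑ i ∈ s, tmul (f i) b := by
  simp [← tmulₗ_apply]

theorem tmul_sum {ι : Type*} (s : Finset ι) (a : A) (f : ι → B) :
    tmul a (∑ i ∈ s, f i) = ∑ i ∈ s, tmul a (f i) := by
  simp [← tmulₗ_apply]

theorem star_tmul (a : A) (b : B) : star (tmul a b) = tmul (star a) (star b) :=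
  ext_rep fun π ρ => by
    rw [map_star, rep_tmul, rep_tmul, HilbertTensor.star_mapOp, map_star, map_star]

end MinTensor

/-! ## Magic unitaries from unitary matrices -/

section Magic

variable {A : Type u} [CStarAlgebra A]

theorem eq_zero_of_sum_star_mul_self {ι : Type*} {s : Finset ι} {x : ι → A}
    (h : ∑ i ∈ s, star (x i) * x i = 0) {i : ι} (hi : i ∈ s) : x i = 0 := by
  let _ := CStarAlgebra.spectralOrder A
  have := CStarAlgebra.spectralOrderedRing A
  exact CStarRing.star_mul_self_eq_zero_iff _ |>.mp
    ((Finset.sum_eq_zero_iff_of_nonneg fun i _ => star_mul_self_nonneg (x i)).mp h i hi)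

/-- Each weight is absorbed into `x i` as a square root, which reduces to the unweighted case.
Nonnegativity is required only where `x i ≠ 0`, because the sign of a weight is sometimes known only
there. -/
theorem smul_eq_zero_of_sum_smul_star_mul_self {ι : Type*} {s : Finset ι} {c : ι → ℝ} {x : ι → A}
    (hc : ∀ i ∈ s, x i ≠ 0 → 0 ≤ c i) (h : ∑ i ∈ s, c i • (star (x i) * x i) = 0) {i : ι}
    (hi : i ∈ s) (hci : c i ≠ 0) : x i = 0 := by
  by_contra hx
  have h' : ∑ i ∈ s, star (√(c i) • x i) * (√(c i) • x i) = 0 := by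
    rw [← h]
    refine Finset.sum_congr rfl fun k hk => ?_
    by_cases hk0 : x k = 0
    · simp [hk0]
    · rw [star_smul, star_trivial, smul_mul_smul_comm, Real.mul_self_sqrt (hc k hk hk0)]
  have h0 := eq_zero_of_sum_star_mul_self h' hi
  rw [smul_eq_zero, Real.sqrt_eq_zero (hc i hi hx)] at h0
  exact h0.elim hci hx

variable {X K : Type*} [Fintype X] [DecidableEq X] [DecidableEq K]

/-- The row and column relations of a unitary matrix with row sums `1`, whose rows are graded by
`φ : X → K` by means of the matrix `q`. -/
structure IsGraded (φ : X → K) (u : Matrix X X A) (q : K → K → A) : Prop where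
  surj : Function.Surjective φ
  unitary : u ∈ unitary (Matrix X X A)
  row_sum : ∀ σ, ∑ τ, u σ τ = 1
  mul_eq : ∀ σ τ i, q (φ σ) i * u σ τ = if φ τ = i then u σ τ else 0

theorem Matrix.unitary_row {u : Matrix X X A} (hu : u ∈ unitary (Matrix X X A)) (σ σ' : X) :
    ∑ τ, u σ τ * star (u σ' τ) = if σ = σ' then 1 else 0 := by
  have : (u * star u) σ σ' = (1 : Matrix X X A) σ σ' := by rw [Unitary.mul_star_self_of_mem hu]
  simpa [Matrix.mul_apply, Matrix.one_apply] using this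

theorem Matrix.unitary_col {u : Matrix X X A} (hu : u ∈ unitary (Matrix X X A)) (τ τ' : X) :
    ∑ σ, star (u σ τ) * u σ τ' = if τ = τ' then 1 else 0 := by
  have : (star u * u) τ τ' = (1 : Matrix X X A) τ τ' := by rw [Unitary.star_mul_self_of_mem hu]
  simpa [Matrix.mul_apply, Matrix.one_apply] using this

theorem Matrix.mem_unitary_of_row_col {u : Matrix X X A}
    (h₁ : ∀ σ σ', ∑ τ, u σ τ * star (u σ' τ) = if σ = σ' then 1 else 0)
    (h₂ : ∀ τ τ', ∑ σ, star (u σ τ) * u σ τ' = if τ = τ' then 1 else 0) :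
    u ∈ unitary (Matrix X X A) := by
  refine Unitary.mem_iff.mpr ⟨?_, ?_⟩
  · ext τ τ'
    simpa [Matrix.mul_apply, Matrix.one_apply] using h₂ τ τ'
  · ext σ σ'
    simpa [Matrix.mul_apply, Matrix.one_apply] using h₁ σ σ'

/-- The row condition says that `u` fixes the constant vector; a unitary fixing a vector has an
adjoint fixing it too. -/
theorem Matrix.col_sum_of_unitary {u : Matrix X X A} (hu : u ∈ unitary (Matrix X X A))
    (h : ∀ σ, ∑ τ, u σ τ = 1) (τ : X) : ∑ σ, u σ τ = 1 := by
  have h1 : ∑ σ, star (u σ τ) = 1 := by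
    calc ∑ σ, star (u σ τ) = ∑ σ, star (u σ τ) * ∑ τ', u σ τ' := by simp [h]
      _ = ∑ τ', ∑ σ, star (u σ τ) * u σ τ' := by
        simp_rw [Finset.mul_sum]
        exact Finset.sum_comm
      _ = 1 := by simp [Matrix.unitary_col hu]
  rw [← star_one, ← h1, star_sum]
  simp

namespace IsGraded

variable {φ : X → K} {u : Matrix X X A} {q : K → K → A}

theorem eq_sum_row (h : IsGraded φ u q) (σ : X) (i : K) :
    q (φ σ) i = ∑ τ, if φ τ = i then u σ τ else 0 := by
  rw [← mul_one (q _ _), ← h.row_sum σ, Finset.mul_sum]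
  exact Finset.sum_congr rfl fun τ _ => h.mul_eq σ τ i

theorem mul_row (h : IsGraded φ u q) (k i j : K) :
    q k i * q k j = if i = j then q k i else 0 := by
  obtain ⟨σ, rfl⟩ := h.surj k
  rw [h.eq_sum_row σ j, Finset.mul_sum]
  simp_rw [mul_ite, h.mul_eq, mul_zero]
  split_ifs with hij
  · subst hij
    rw [h.eq_sum_row]
    exact Finset.sum_congr rfl fun τ _ => by split_ifs <;> rfl
  · refine Finset.sum_eq_zero fun τ _ => ?_
    split_ifs with h1 h2
    · exact absurd (h2.symm.trans h1) hij
    · rfl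
    · rfl

/-- Multiplying `1 = ∑ τ, u σ τ * star (u σ τ)` by `q (φ σ) i` keeps exactly the terms with `φ τ =
i`, a manifestly self-adjoint sum. -/
theorem star_eq (h : IsGraded φ u q) (k i : K) : star (q k i) = q k i := by
  obtain ⟨σ, rfl⟩ := h.surj k
  have h1 : q (φ σ) i = ∑ τ, if φ τ = i then u σ τ * star (u σ τ) else 0 := by
    have h2 := Matrix.unitary_row h.unitary σ σ
    rw [if_pos rfl] at h2
    rw [← mul_one (q _ _), ← h2, Finset.mul_sum]
    refine Finset.sum_congr rfl fun τ _ => ?_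
    rw [← mul_assoc, h.mul_eq]
    split_ifs <;> simp
  rw [h1, star_sum]
  refine Finset.sum_congr rfl fun τ _ => ?_
  split_ifs <;> simp

theorem star_mul_self (h : IsGraded φ u q) (k i : K) : star (q k i) * q k i = q k i := by
  rw [h.star_eq, h.mul_row, if_pos rfl]

theorem row_sum_eq_one [Fintype K] (h : IsGraded φ u q) (k : K) : ∑ i, q k i = 1 := by
  obtain ⟨σ, rfl⟩ := h.surj k
  simp_rw [h.eq_sum_row]
  rw [Finset.sum_comm]
  simp [h.row_sum]

/-- The left side is `∑ σ, q (φ σ) i` grouped by fibres. Writing each projection as `star q * q` and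
expanding along row `σ`, the orthonormality of the columns of `u` counts the points over `i`. -/
theorem sum_col_smul [Fintype K] (h : IsGraded φ u q) (i : K) :
    ∑ k, (Fintype.card {τ // φ τ = k} : ℝ) • q k i = (Fintype.card {τ // φ τ = i} : ℝ) • 1 := by
  have h1 : ∑ σ, q (φ σ) i = (Fintype.card {τ // φ τ = i} : ℝ) • 1 := by
    calc ∑ σ, q (φ σ) i = ∑ σ, star (q (φ σ) i) * q (φ σ) i := by simp [h.star_mul_self]
      _ = ∑ σ, ∑ τ, ∑ τ', if φ τ = i ∧ φ τ' = i then star (u σ τ) * u σ τ' else 0 := by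
        refine Finset.sum_congr rfl fun σ _ => ?_
        rw [h.eq_sum_row, star_sum, Finset.sum_mul_sum]
        refine Finset.sum_congr rfl fun τ _ => Finset.sum_congr rfl fun τ' _ => ?_
        by_cases h1 : φ τ = i <;> by_cases h2 : φ τ' = i <;> simp [h1, h2]
      _ = ∑ τ, ∑ τ', if φ τ = i ∧ φ τ' = i then ∑ σ, star (u σ τ) * u σ τ' else 0 := by
        rw [Finset.sum_comm]
        refine Finset.sum_congr rfl fun τ _ => ?_
        rw [Finset.sum_comm]
        refine Finset.sum_congr rfl fun τ' _ => ?_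
        split_ifs <;> simp
      _ = ∑ τ, if φ τ = i then 1 else 0 := by
        refine Finset.sum_congr rfl fun τ _ => ?_
        simp_rw [Matrix.unitary_col h.unitary]
        rw [Finset.sum_eq_single τ]
        · simp
        · intro τ' _ hne
          simp [hne.symm]
        · simp
      _ = _ := by
        rw [Finset.sum_boole, Fintype.card_subtype, Nat.cast_smul_eq_nsmul, nsmul_one]
  rw [← h1, ← Finset.sum_fiberwise (g := φ)]
  refine Finset.sum_congr rfl fun k _ => ?_
  rw [Finset.sum_congr rfl fun σ hσ => by rw [(Finset.mem_filter.mp hσ).2], Finset.sum_const,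
    Fintype.card_subtype, Nat.cast_smul_eq_nsmul]

theorem card_pos (h : IsGraded φ u q) (k : K) : (0 : ℝ) < Fintype.card {τ // φ τ = k} := by
  obtain ⟨σ, hσ⟩ := h.surj k
  exact Nat.cast_pos.mpr (Fintype.card_pos_iff.mpr ⟨⟨σ, hσ⟩⟩)

/-- This is the weighted column sum compressed by the projection `q l i`, with the term `k = l`
moved to the right. The left side is positive, so the sign of the right side carries information. -/
theorem smul_eq_sum_erase [Fintype K] (h : IsGraded φ u q) (l i : K) :
    ∑ k ∈ Finset.univ.erase l, (Fintype.card {τ // φ τ = k} : ℝ) •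
        (star (q k i * q l i) * (q k i * q l i)) =
      ((Fintype.card {τ // φ τ = i} : ℝ) - Fintype.card {τ // φ τ = l}) • q l i := by
  have h1 := congrArg (fun x => q l i * x * q l i) (h.sum_col_smul i)
  have h2 : ∀ k, star (q k i * q l i) * (q k i * q l i) = q l i * q k i * q l i := fun k => by
    rw [star_mul, h.star_eq, h.star_eq, mul_assoc, ← mul_assoc (q k i), h.mul_row, if_pos rfl,
      mul_assoc]
  simp only [Finset.mul_sum, Finset.sum_mul, mul_smul_comm, smul_mul_assoc, mul_one,
    h.mul_row, if_true] at h1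
  rw [← Finset.add_sum_erase _ _ (Finset.mem_univ l), h.mul_row, if_pos rfl, h.mul_row,
    if_pos rfl] at h1
  simp_rw [h2]
  rw [sub_smul, ← h1]
  abel

theorem card_le_of_ne_zero [Fintype K] (h : IsGraded φ u q) {k i : K} (hq : q k i ≠ 0) :
    (Fintype.card {τ // φ τ = k} : ℝ) ≤ Fintype.card {τ // φ τ = i} := by
  by_contra! hlt
  have h1 := h.smul_eq_sum_erase k i
  -- The index `none` carries the extra term with weight `m k - m i`, positive by assumption. It
  -- cancels the right side of the compressed identity, leaving a vanishing sum of positive terms.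
  have h2 : ∑ l : Option {l // l ∈ Finset.univ.erase k},
      (l.elim ((Fintype.card {τ // φ τ = k} : ℝ) - Fintype.card {τ // φ τ = i})
        fun l => (Fintype.card {τ // φ τ = l.1} : ℝ)) •
        (star (l.elim (q k i) fun l => q l.1 i * q k i) *
          (l.elim (q k i) fun l => q l.1 i * q k i)) = 0 := by
    rw [Fintype.sum_option]
    simp only [Option.elim]
    rw [Finset.sum_coe_sort (Finset.univ.erase k) fun l => (Fintype.card {τ // φ τ = l} : ℝ) •
      (star (q l i * q k i) * (q l i * q k i)), h1, h.star_mul_self, ← add_smul]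
    simp
  refine hq (smul_eq_zero_of_sum_smul_star_mul_self ?_ h2 (Finset.mem_univ none)
    (sub_ne_zero.mpr hlt.ne'))
  rintro (_ | l) _ _
  · exact (sub_pos.mpr hlt).le
  · exact Nat.cast_nonneg _

/-- By the row and weighted column sums, `∑ k i, m k * (m i - m k) • q k i` equals `∑ i, m i ^ 2 - ∑
k, m k ^ 2 = 0`. The inequality already proved makes every nonzero term positive, hence every term
vanishes. -/
theorem card_eq_of_ne_zero [Fintype K] (h : IsGraded φ u q) {k i : K} (hq : q k i ≠ 0) :
    (Fintype.card {τ // φ τ = k} : ℝ) = Fintype.card {τ // φ τ = i} := by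
  by_contra hne
  have h1 : ∑ p : K × K, ((Fintype.card {τ // φ τ = p.1} : ℝ) *
      (Fintype.card {τ // φ τ = p.2} - Fintype.card {τ // φ τ = p.1})) •
        (star (q p.1 p.2) * q p.1 p.2) = 0 := by
    simp_rw [h.star_mul_self, mul_sub, sub_smul]
    rw [Finset.sum_sub_distrib, Fintype.sum_prod_type_right, Fintype.sum_prod_type, sub_eq_zero]
    refine Finset.sum_congr rfl fun k _ => ?_
    simp only [mul_comm _ (Fintype.card {τ // φ τ = k} : ℝ), mul_smul]
    simp only [← Finset.smul_sum, h.sum_col_smul, h.row_sum_eq_one]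
  refine hq (smul_eq_zero_of_sum_smul_star_mul_self (i := (k, i)) ?_ h1 (Finset.mem_univ _)
    (mul_ne_zero (h.card_pos k).ne' (sub_ne_zero.mpr (Ne.symm hne))))
  exact fun p _ hp => mul_nonneg (Nat.cast_nonneg _) (sub_nonneg.mpr (h.card_le_of_ne_zero hp))

/-- With equal fibre sizes the right side of the compressed identity is zero, so each `q k i * q l
i` on its left vanishes. -/
theorem mul_col [Fintype K] (h : IsGraded φ u q) {k l : K} (hkl : k ≠ l) (i : K) :
    q k i * q l i = 0 := by
  by_cases hq : q l i = 0
  · simp [hq]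
  have h1 := h.smul_eq_sum_erase l i
  rw [h.card_eq_of_ne_zero hq, sub_self, zero_smul] at h1
  exact smul_eq_zero_of_sum_smul_star_mul_self (fun _ _ _ => Nat.cast_nonneg _) h1
    (Finset.mem_erase.mpr ⟨hkl, Finset.mem_univ k⟩) (h.card_pos k).ne'

theorem col_sum_eq_one [Fintype K] (h : IsGraded φ u q) (i : K) : ∑ k, q k i = 1 := by
  have h1 := h.sum_col_smul i
  have h2 : ∀ k, (Fintype.card {τ // φ τ = k} : ℝ) • q k i =
      (Fintype.card {τ // φ τ = i} : ℝ) • q k i := fun k => by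
    by_cases hq : q k i = 0
    · simp [hq]
    · rw [h.card_eq_of_ne_zero hq]
  simp_rw [h2] at h1
  rw [← Finset.smul_sum] at h1
  exact smul_right_injective _ (h.card_pos i).ne' h1

theorem mul_eq_of_col [Fintype K] (h : IsGraded φ u q) (σ τ : X) (k : K) :
    q k (φ τ) * u σ τ = if φ σ = k then u σ τ else 0 := by
  split_ifs with hk
  · rw [← hk, h.mul_eq, if_pos rfl]
  · have h1 := h.mul_eq σ τ (φ τ)
    rw [if_pos rfl] at h1
    rw [← h1, ← mul_assoc, h.mul_col (Ne.symm hk), zero_mul]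

end IsGraded

/-! ### Source and target gradings combined -/

variable {L : Type*} [Fintype K] [Fintype L] [DecidableEq L] {s : X → K} {t : X → L}
  {u : Matrix X X A} {q : K → K → A} {r : L → L → A}

/-- If different rows with the same source and target are orthogonal, then the final projection of
an entry is cut off by the source and target projections. -/
theorem IsGraded.mul_star_self_eq (hs : IsGraded s u q) (ht : IsGraded t (u.map star) r)
    (ho : ∀ σ σ' τ, s σ = s σ' → t σ = t σ' → σ ≠ σ' → u σ τ * star (u σ' τ) = 0) (σ τ : X) :
    q (s σ) (s τ) * r (t σ) (t τ) * star (u σ τ) = u σ τ * star (u σ τ) := by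
  have h1 : ∀ ρ, u ρ τ * r (t σ) (t τ) = if t ρ = t σ then u ρ τ else 0 := fun ρ => by
    have := congrArg star (ht.mul_eq_of_col ρ τ (t σ))
    rw [star_mul, ht.star_eq, Matrix.map_apply, star_star] at this
    rw [this]
    split_ifs <;> simp
  -- Insert `1 = ∑ ρ, u ρ τ` between the two projections. They keep only the `ρ` parallel to `σ`,
  -- and restricted orthogonality against `star (u σ τ)` leaves only `ρ = σ`.
  rw [← mul_one (q _ _), ← Matrix.col_sum_of_unitary hs.unitary hs.row_sum τ, Finset.mul_sum,
    Finset.sum_mul, Finset.sum_mul, Finset.sum_eq_single σ]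
  · rw [hs.mul_eq, if_pos rfl, h1, if_pos rfl]
  · intro ρ _ hρ
    rw [hs.mul_eq_of_col]
    split_ifs with hsρ
    · rw [h1]
      split_ifs with htρ
      · exact ho _ _ _ hsρ htρ hρ
      · simp
    · simp
  · simp

theorem IsGraded.eq_zero (hs : IsGraded s u q) (ht : IsGraded t (u.map star) r)
    (ho : ∀ σ σ' τ, s σ = s σ' → t σ = t σ' → σ ≠ σ' → u σ τ * star (u σ' τ) = 0) {σ τ : X}
    (h : q (s σ) (s τ) * r (t σ) (t τ) = 0) : u σ τ = 0 := by
  have h1 := hs.mul_star_self_eq ht ho σ τ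
  rw [h, zero_mul, eq_comm, CStarRing.mul_star_self_eq_zero_iff] at h1
  exact h1

end Magic

/-! ## Linear maps `L²(X) → L²(X) ⊗ A` and their matrices -/

section CorepMatrix

variable {A : Type u} [CStarAlgebra A] {X K : Type*} [Fintype X] [DecidableEq X]

/-- The linear map `L²(X) → L²(X) ⊗ A` with a given matrix. -/
def corepOfMatrix (u : Matrix X X A) : (X → ℂ) →ₗ[ℂ] (X → A) where
  toFun f x := ∑ y, f y • u x y
  map_add' f g := by
    funext x
    simp [add_smul, Finset.sum_add_distrib]
  map_smul' c f := by
    funext x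
    simp [mul_smul, Finset.smul_sum]

theorem corepOfMatrix_apply (u : Matrix X X A) (f : X → ℂ) (x : X) :
    corepOfMatrix u f x = ∑ y, f y • u x y := rfl

theorem corepMatrix_apply (β : (X → ℂ) →ₗ[ℂ] (X → A)) (x y : X) :
    corepMatrix β x y = β (Pi.single y 1) x := rfl

theorem corepMatrix_corepOfMatrix (u : Matrix X X A) : corepMatrix (corepOfMatrix u) = u := by
  ext x y
  simp [corepMatrix_apply, corepOfMatrix_apply, Pi.single_apply]

theorem corepOfMatrix_corepMatrix (β : (X → ℂ) →ₗ[ℂ] (X → A)) :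
    corepOfMatrix (corepMatrix β) = β := by
  refine LinearMap.pi_ext' fun y => LinearMap.ext_ring ?_
  funext x
  simp [corepMatrix_apply, corepOfMatrix_apply, Pi.single_apply]

theorem apply_eq_sum_corepMatrix (β : (X → ℂ) →ₗ[ℂ] (X → A)) (f : X → ℂ) (x : X) :
    β f x = ∑ y, f y • corepMatrix β x y := by
  conv_lhs => rw [← corepOfMatrix_corepMatrix β]
  rfl

theorem corepMatrix_injective :
    Function.Injective (corepMatrix : ((X → ℂ) →ₗ[ℂ] (X → A)) → Matrix X X A) :=
  Function.LeftInverse.injective corepOfMatrix_corepMatrix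

theorem corepMatrix_adjointCorep (β : (X → ℂ) →ₗ[ℂ] (X → A)) :
    corepMatrix (adjointCorep β) = (corepMatrix β).map star :=
  corepMatrix_corepOfMatrix ((corepMatrix β).map star)

theorem map_one_eq_one_iff (β : (X → ℂ) →ₗ[ℂ] (X → A)) :
    (β (fun _ => 1) = fun _ => 1) ↔ ∀ x, ∑ y, corepMatrix β x y = 1 := by
  simp [funext_iff, apply_eq_sum_corepMatrix]

theorem Ad_diagonal_apply (β : (X → ℂ) →ₗ[ℂ] (X → A)) (d : X → ℂ) (x y : X) :
    Ad β (Matrix.diagonal d) x y =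
      ∑ z, d z • (corepMatrix β x z * star (corepMatrix β y z)) := by
  have h : tensorOne A (Matrix.diagonal d) = Matrix.diagonal fun z => algebraMap ℂ A (d z) := by
    simp [tensorOne, Matrix.diagonal_map]
  rw [Ad, h, Matrix.mul_apply]
  refine Finset.sum_congr rfl fun z _ => ?_
  rw [Matrix.mul_diagonal, Matrix.conjTranspose_apply, ← Algebra.commutes, ← Algebra.smul_def,
    smul_mul_assoc]

/-- The representation of `C(K)` on `L²(X)` by multiplication along `φ : X → K`. -/
abbrev pullDiag (φ : X → K) : (K → ℂ) →ₗ[ℂ] Matrix X X ℂ :=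
  Matrix.diagonalLinearMap X ℂ ℂ ∘ₗ LinearMap.funLeft ℂ ℂ φ

theorem pullDiag_apply (φ : X → K) (f : K → ℂ) :
    pullDiag φ f = Matrix.diagonal fun x => f (φ x) := rfl

theorem diagonal_comp_mem_tensorSubspace [Fintype K] (φ : X → K)
    (g : K → A) :
    Matrix.diagonal (fun x => g (φ x)) ∈ tensorSubspace (LinearMap.range (pullDiag φ)) A := by
  classical
  have h : Matrix.diagonal (fun x => g (φ x)) = ∑ k, Matrix.of fun x y =>
      (pullDiag φ (Pi.single k 1)) x y • g k := by
    ext x y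
    rw [Matrix.sum_apply]
    by_cases hxy : x = y
    · subst hxy
      simp [Pi.single_apply, Matrix.diagonalLinearMap]
    · simp [hxy, Matrix.diagonalLinearMap]
  rw [h]
  exact Submodule.sum_mem _ fun k _ =>
    Submodule.subset_span ⟨_, LinearMap.mem_range_self _ _, _, rfl⟩

theorem exists_of_mem_tensorSubspace_pullDiag {φ : X → K} {M : Matrix X X A}
    (h : M ∈ tensorSubspace (LinearMap.range (pullDiag φ)) A) :
    ∃ g : K → A, M = Matrix.diagonal fun x => g (φ x) := by
  induction h using Submodule.span_induction with
  | mem M hM =>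
    obtain ⟨_, ⟨f, rfl⟩, a, rfl⟩ := hM
    refine ⟨fun k => f k • a, ?_⟩
    ext x y
    by_cases hxy : x = y <;> simp [pullDiag_apply, Matrix.diagonal_apply, hxy]
  | zero => exact ⟨0, by simp⟩
  | add M N _ _ hM hN =>
    obtain ⟨g, rfl⟩ := hM
    obtain ⟨g', rfl⟩ := hN
    exact ⟨g + g', by simp [Matrix.diagonal_add]⟩
  | smul c M _ hM =>
    obtain ⟨g, rfl⟩ := hM
    exact ⟨c • g, by ext x y; by_cases hxy : x = y <;> simp [hxy]⟩

/-! ### Gradings, adjoint actions and induced co-actions -/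

variable [DecidableEq K]

/-- If `U (T ⊗ 1) U*` is a diagonal matrix `D` constant on fibres, multiplying by `U` on the right
gives `U (T ⊗ 1) = D U`. For `T` the indicator of a fibre, the entries of this identity are the
grading relation. -/
theorem exists_isGraded {β : (X → ℂ) →ₗ[ℂ] (X → A)} {φ : X → K}
    (hφ : Function.Surjective φ) (hu : IsUnitaryCorep β) (h1 : ∀ x, ∑ y, corepMatrix β x y = 1)
    (h : ∀ f, Ad β (pullDiag φ f) ∈ tensorSubspace (LinearMap.range (pullDiag φ)) A) :
    ∃ q : K → K → A, IsGraded φ (corepMatrix β) q := by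
  choose g hg using fun f => exists_of_mem_tensorSubspace_pullDiag (h f)
  refine ⟨fun k i => g (Pi.single i 1) k, hφ, hu, h1, fun σ τ i => ?_⟩
  have h2 : ∀ σ', (if σ = σ' then g (Pi.single i 1) (φ σ) else 0) =
      ∑ z, if φ z = i then corepMatrix β σ z * star (corepMatrix β σ' z) else 0 := fun σ' => by
    have := congrFun (congrFun (hg (Pi.single i 1)) σ) σ'
    rw [pullDiag_apply, Ad_diagonal_apply, Matrix.diagonal_apply] at this
    rw [← this]
    refine Finset.sum_congr rfl fun z _ => ?_
    by_cases hz : φ z = i <;> simp [hz]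
  calc g (Pi.single i 1) (φ σ) * corepMatrix β σ τ
      = ∑ σ', (if σ = σ' then g (Pi.single i 1) (φ σ) else 0) * corepMatrix β σ' τ := by simp
    _ = ∑ z, if φ z = i then
          corepMatrix β σ z * ∑ σ', star (corepMatrix β σ' z) * corepMatrix β σ' τ else 0 := by
        simp_rw [h2, Finset.sum_mul]
        rw [Finset.sum_comm]
        refine Finset.sum_congr rfl fun z _ => ?_
        split_ifs <;> simp [Finset.mul_sum, mul_assoc]
    _ = _ := by
        simp_rw [Matrix.unitary_col hu]
        rw [Finset.sum_eq_single τ]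
        · simp
        · intro z _ hz
          simp [hz]
        · simp

theorem IsGraded.sum_smul_mul_star [Fintype K] {φ : X → K} {u : Matrix X X A} {q : K → K → A}
    (h : IsGraded φ u q) (f : K → ℂ) (σ σ' : X) :
    ∑ τ, f (φ τ) • (u σ τ * star (u σ' τ)) =
      if σ = σ' then ∑ i, f i • q (φ σ) i else 0 := by
  have h1 : ∀ τ, f (φ τ) • (u σ τ * star (u σ' τ)) =
      (∑ i, f i • q (φ σ) i) * (u σ τ * star (u σ' τ)) := fun τ => by
    rw [Finset.sum_mul, Finset.sum_eq_single (φ τ)]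
    · rw [smul_mul_assoc, ← mul_assoc, h.mul_eq, if_pos rfl]
    · intro i _ hi
      rw [smul_mul_assoc, ← mul_assoc, h.mul_eq, if_neg hi.symm, zero_mul, smul_zero]
    · simp
  simp_rw [h1]
  rw [← Finset.mul_sum, Matrix.unitary_row h.unitary]
  split_ifs <;> simp

theorem IsGraded.Ad_mem [Fintype K] {β : (X → ℂ) →ₗ[ℂ] (X → A)} {φ : X → K}
    {q : K → K → A} (h : IsGraded φ (corepMatrix β) q) (f : K → ℂ) :
    Ad β (pullDiag φ f) ∈ tensorSubspace (LinearMap.range (pullDiag φ)) A := by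
  have h1 : Ad β (pullDiag φ f) = Matrix.diagonal fun x => ∑ i, f i • q (φ x) i := by
    ext x y
    rw [pullDiag_apply, Ad_diagonal_apply, h.sum_smul_mul_star, Matrix.diagonal_apply]
  rw [h1]
  exact diagonal_comp_mem_tensorSubspace φ fun k => ∑ i, f i • q k i

/-- The homomorphism `C(K) → C(K) ⊗ A` with matrix `q`. -/
def IsGraded.coaction [Fintype K] {φ : X → K} {u : Matrix X X A} {q : K → K → A}
    (h : IsGraded φ u q) : (K → ℂ) →⋆ₐ[ℂ] (K → A) where
  toFun f k := ∑ i, f i • q k i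
  map_one' := funext fun k => by simp [h.row_sum_eq_one]
  map_mul' f g := funext fun k => by
    rw [Pi.mul_apply, Finset.sum_mul_sum]
    refine Finset.sum_congr rfl fun i _ => ?_
    rw [Finset.sum_eq_single i]
    · rw [smul_mul_smul_comm, h.mul_row, if_pos rfl, Pi.mul_apply]
    · intro j _ hj
      rw [smul_mul_smul_comm, h.mul_row, if_neg hj.symm, smul_zero]
    · simp
  map_zero' := funext fun k => by simp
  map_add' f g := funext fun k => by simp [add_smul, Finset.sum_add_distrib]
  commutes' c := funext fun k => by
    simp [← Finset.smul_sum, h.row_sum_eq_one, Algebra.algebraMap_eq_smul_one]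
  map_star' f := funext fun k => by simp [star_sum, h.star_eq]

theorem IsGraded.coaction_apply [Fintype K] {φ : X → K} {u : Matrix X X A} {q : K → K → A}
    (h : IsGraded φ u q) (f : K → ℂ) (k : K) : h.coaction f k = ∑ i, f i • q k i := rfl

theorem IsGraded.coaction_single [Fintype K] {φ : X → K} {u : Matrix X X A} {q : K → K → A}
    (h : IsGraded φ u q) (i k : K) : h.coaction (Pi.single i 1) k = q k i := by
  simp [h.coaction_apply, Pi.single_apply]

/-- Sum the formula for `Δ (u σ τ)` over the `τ` in the fibre of `i`. The right legs then depend on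
the middle index `ρ` only through `φ ρ`, so the left legs can be summed over fibres as well. -/
theorem IsGraded.comul_eq [Fintype K] {φ : X → K} {u : Matrix X X A} {q : K → K → A}
    (h : IsGraded φ u q) {Δ : A →⋆ₐ[ℂ] MinTensor A A}
    (hΔ : ∀ x y, Δ (u x y) = ∑ z, MinTensor.tmul (u x z) (u z y)) (k i : K) :
    Δ (q k i) = ∑ l, MinTensor.tmul (q k l) (q l i) := by
  obtain ⟨σ, rfl⟩ := h.surj k
  calc Δ (q (φ σ) i) = ∑ τ, ∑ ρ, if φ τ = i then MinTensor.tmul (u σ ρ) (u ρ τ) else 0 := by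
        rw [h.eq_sum_row, map_sum]
        refine Finset.sum_congr rfl fun τ _ => ?_
        split_ifs <;> simp [hΔ]
    _ = ∑ ρ, MinTensor.tmul (u σ ρ) (q (φ ρ) i) := by
        rw [Finset.sum_comm]
        refine Finset.sum_congr rfl fun ρ _ => ?_
        rw [h.eq_sum_row, MinTensor.tmul_sum]
        refine Finset.sum_congr rfl fun τ _ => ?_
        split_ifs <;> simp [MinTensor.tmul_zero]
    _ = _ := by
        rw [← Finset.sum_fiberwise (g := φ)]
        refine Finset.sum_congr rfl fun l _ => ?_
        rw [h.eq_sum_row σ l, MinTensor.sum_tmul, Finset.sum_filter]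
        refine Finset.sum_congr rfl fun ρ _ => ?_
        split_ifs with hρ
        · rw [hρ]
        · rw [MinTensor.zero_tmul]

theorem IsGraded.isCoaction [Fintype K] {φ : X → K} {u : Matrix X X A} {q : K → K → A}
    (h : IsGraded φ u q) {Q : CompactQuantumGroup A}
    (hΔ : ∀ x y, Q.comul (u x y) = ∑ z, MinTensor.tmul (u x z) (u z y)) :
    IsCoaction Q h.coaction where
  coassoc f k := by
    simp_rw [h.coaction_single, h.coaction_apply, map_sum, map_smul, h.comul_eq hΔ,
      MinTensor.tmul_sum, MinTensor.tmul_smul, Finset.smul_sum]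
    exact Finset.sum_comm
  dense := by
    have h1 : Submodule.span ℂ {F : K → A | ∃ (f : K → ℂ) (a : A),
        F = fun x => h.coaction f x * a} = ⊤ := by
      refine Submodule.eq_top_iff'.mpr fun F => ?_
      -- Orthogonality in the columns removes all `l ≠ k` after summation over `i`, and the row sum
      -- restores `F k`. So the span is everything, not merely dense.
      have h2 : F = ∑ i, fun k => h.coaction (Pi.single i 1) k * ∑ l, q l i * F l := by
        funext k
        rw [Finset.sum_apply]
        simp_rw [h.coaction_single, Finset.mul_sum, ← mul_assoc]
        rw [Finset.sum_comm, Finset.sum_eq_single k]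
        · simp [h.mul_row, ← Finset.sum_mul, h.row_sum_eq_one]
        · intro l _ hl
          simp [h.mul_col hl.symm]
        · simp
      rw [h2]
      exact Submodule.sum_mem _ fun i _ => Submodule.subset_span ⟨_, _, rfl⟩
    rw [h1]
    exact dense_univ

end CorepMatrix

/-! ### Restricted orthogonality in terms of matrix entries -/

namespace Multigraph

variable {V E : Type*} (G : Multigraph V E) [Fintype E] [DecidableEq E] [DecidableEq V]
  {A : Type u} [CStarAlgebra A]

theorem edgeProj_mul_diagonal_mul (k l : V) (d : E → ℂ) :
    G.edgeProj k l * (Matrix.diagonal d * G.edgeProj k l) =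
      Matrix.diagonal fun τ => if G.s τ = k ∧ G.t τ = l then d τ else 0 := by
  rw [edgeProj, Matrix.diagonal_mul_diagonal, Matrix.diagonal_mul_diagonal]
  congr 1
  funext τ
  split_ifs <;> simp

theorem mem_diagBlock_iff {k l : V} {x : Matrix E E ℂ} :
    x ∈ G.diagBlock k l ↔
      ∃ d : E → ℂ, Matrix.diagonal (fun τ => if G.s τ = k ∧ G.t τ = l then d τ else 0) = x := by
  simp_rw [← edgeProj_mul_diagonal_mul]
  constructor
  · rintro ⟨_, ⟨d, rfl⟩, rfl⟩
    exact ⟨d, rfl⟩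
  · rintro ⟨d, rfl⟩
    exact ⟨_, ⟨d, rfl⟩, rfl⟩

theorem diagonal_single_mem_diagBlock (τ : E) :
    Matrix.diagonal (Pi.single τ 1) ∈ G.diagBlock (G.s τ) (G.t τ) := by
  refine G.mem_diagBlock_iff.mpr ⟨Pi.single τ 1, ?_⟩
  congr 1
  funext σ
  by_cases h : σ = τ
  · simp [h]
  · simp [h]

theorem tensorOne_edgeProj_mul_mul (k l : V) (M : Matrix E E A) (σ σ' : E) :
    (tensorOne A (G.edgeProj k l) * M * tensorOne A (G.edgeProj k l)) σ σ' =
      if (G.s σ = k ∧ G.t σ = l) ∧ G.s σ' = k ∧ G.t σ' = l then M σ σ' else 0 := by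
  have h : tensorOne A (G.edgeProj k l) =
      Matrix.diagonal fun τ => if G.s τ = k ∧ G.t τ = l then 1 else 0 := by
    rw [tensorOne, edgeProj, Matrix.diagonal_map (map_zero _)]
    congr 1
    funext τ
    simp [apply_ite (algebraMap ℂ A)]
  rw [h, Matrix.mul_diagonal, Matrix.diagonal_mul]
  by_cases h1 : G.s σ = k ∧ G.t σ = l <;> by_cases h2 : G.s σ' = k ∧ G.t σ' = l <;> simp [h1, h2]

theorem eq_zero_of_mem_tensorSubspace_diagBlock {k l : V} {M : Matrix E E A}
    (h : M ∈ tensorSubspace (G.diagBlock k l) A) {σ σ' : E} (hσ : σ ≠ σ') : M σ σ' = 0 := by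
  induction h using Submodule.span_induction with
  | mem M hM =>
    obtain ⟨x, hx, a, rfl⟩ := hM
    obtain ⟨d, rfl⟩ := G.mem_diagBlock_iff.mp hx
    simp [Matrix.diagonal_apply_ne _ hσ]
  | zero => rfl
  | add M N _ _ hM hN => rw [Matrix.add_apply, hM, hN, add_zero]
  | smul c M _ hM => rw [Matrix.smul_apply, hM, smul_zero]

theorem diagonal_mem_tensorSubspace_diagBlock {k l : V} {d : E → A}
    (h : ∀ τ, ¬(G.s τ = k ∧ G.t τ = l) → d τ = 0) :
    Matrix.diagonal d ∈ tensorSubspace (G.diagBlock k l) A := by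
  have h1 : Matrix.diagonal d = ∑ τ, Matrix.of fun x y =>
      (Matrix.diagonal (Pi.single τ (1 : ℂ)) : Matrix E E ℂ) x y • d τ := by
    ext x y
    rw [Matrix.sum_apply]
    by_cases hxy : x = y
    · subst hxy
      simp [Pi.single_apply]
    · simp [hxy]
  rw [h1]
  refine Submodule.sum_mem _ fun τ _ => ?_
  by_cases hτ : G.s τ = k ∧ G.t τ = l
  · refine Submodule.subset_span ⟨_, ?_, d τ, rfl⟩
    rw [← hτ.1, ← hτ.2]
    exact G.diagonal_single_mem_diagBlock τ
  · convert Submodule.zero_mem _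
    ext x y
    simp [h τ hτ]

/-- The entries of `Ad_β(p_τ)` are `u σ τ * star (u σ' τ)`. Cutting by `p_{kl}` selects parallel
`σ`, `σ'`, and lying in `D_{kl} ⊗ A` amounts to the vanishing of the off-diagonal entries. -/
theorem restrictedOrthogonality_iff {β : (E → ℂ) →ₗ[ℂ] (E → A)} :
    G.RestrictedOrthogonality β ↔ ∀ σ σ' τ, G.s σ = G.s σ' → G.t σ = G.t σ' → σ ≠ σ' →
      corepMatrix β σ τ * star (corepMatrix β σ' τ) = 0 := by
  constructor
  · intro h σ σ' τ hs ht hσ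
    have h1 := G.eq_zero_of_mem_tensorSubspace_diagBlock (h (G.s τ) (G.t τ) (G.s σ) (G.t σ)
      ⟨τ, rfl, rfl⟩ ⟨σ, rfl, rfl⟩ _ (G.diagonal_single_mem_diagBlock τ)) hσ
    rw [tensorOne_edgeProj_mul_mul, if_pos ⟨⟨rfl, rfl⟩, hs.symm, ht.symm⟩,
      Ad_diagonal_apply] at h1
    simpa [Pi.single_apply] using h1
  · intro h i j k l _ _ x hx
    obtain ⟨d, rfl⟩ := G.mem_diagBlock_iff.mp hx
    set M := Ad β (Matrix.diagonal fun τ => if G.s τ = i ∧ G.t τ = j then d τ else 0) with hM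
    have h1 : tensorOne A (G.edgeProj k l) * M * tensorOne A (G.edgeProj k l) =
        Matrix.diagonal fun σ => if G.s σ = k ∧ G.t σ = l then M σ σ else 0 := by
      ext σ σ'
      rw [tensorOne_edgeProj_mul_mul, Matrix.diagonal_apply]
      by_cases hσ : σ = σ'
      · subst hσ
        simp
      · rw [if_neg hσ]
        split_ifs with hkl
        · rw [hM, Ad_diagonal_apply]
          refine Finset.sum_eq_zero fun τ _ => ?_
          rw [h σ σ' τ (hkl.1.1.trans hkl.2.1.symm) (hkl.1.2.trans hkl.2.2.symm) hσ, smul_zero]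
        · rfl
    rw [h1]
    exact G.diagonal_mem_tensorSubspace_diagBlock fun τ hτ => if_neg hτ

end Multigraph

/-! ## Undirected multigraphs -/

section Conjugate

variable {A : Type u} [CStarAlgebra A] {X : Type*} [Fintype X]

theorem comul_map_star {Δ : A →⋆ₐ[ℂ] MinTensor A A} {u : Matrix X X A}
    (hΔ : ∀ x y, Δ (u x y) = ∑ z, MinTensor.tmul (u x z) (u z y)) (x y : X) :
    Δ (u.map star x y) = ∑ z, MinTensor.tmul (u.map star x z) (u.map star z y) := by
  simp [map_star, hΔ, star_sum, MinTensor.star_tmul]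

variable [DecidableEq X] {N : Type*} [Fintype N] [DecidableEq N]

theorem Matrix.toBlocks₁₁_mem_unitary {W : Matrix (X ⊕ N) (X ⊕ N) A}
    (hW : W ∈ unitary (Matrix (X ⊕ N) (X ⊕ N) A)) (h₁₂ : ∀ x n, W (Sum.inl x) (Sum.inr n) = 0)
    (h₂₁ : ∀ n x, W (Sum.inr n) (Sum.inl x) = 0) : W.toBlocks₁₁ ∈ unitary (Matrix X X A) :=
  Matrix.mem_unitary_of_row_col
    (fun σ σ' => by
      simpa [Fintype.sum_sum_type, h₁₂, Matrix.toBlocks₁₁] using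
        Matrix.unitary_row hW (Sum.inl σ) (Sum.inl σ'))
    (fun τ τ' => by
      simpa [Fintype.sum_sum_type, h₂₁, Matrix.toBlocks₁₁] using
        Matrix.unitary_col hW (Sum.inl τ) (Sum.inl τ'))

end Conjugate

namespace UndirectedMultigraph

variable {V E : Type*} (G : UndirectedMultigraph V E) [Fintype E] [DecidableEq E]
  {A : Type u} [CStarAlgebra A]

theorem j_injective : Function.Injective G.j :=
  Function.LeftInverse.injective G.j_j

theorem inversion_iff {β : (E → ℂ) →ₗ[ℂ] (E → A)} :
    β ∘ₗ G.J ℂ = G.J A ∘ₗ adjointCorep β ↔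
      ∀ σ τ, corepMatrix β (G.j σ) (G.j τ) = star (corepMatrix β σ τ) := by
  have hJ : ∀ τ, G.J ℂ (Pi.single τ 1) = Pi.single (G.j τ) 1 := fun τ => by
    funext ρ
    have : G.j ρ = τ ↔ ρ = G.j τ := ⟨fun h => by rw [← h, G.j_j], fun h => by rw [h, G.j_j]⟩
    simp [J, LinearMap.funLeft_apply, Pi.single_apply, this]
  have h1 : ∀ σ τ, (β ∘ₗ G.J ℂ) (Pi.single τ 1) σ = corepMatrix β σ (G.j τ) := fun σ τ => by
    rw [LinearMap.comp_apply, hJ, corepMatrix_apply]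
  have h2 : ∀ σ τ, (G.J A ∘ₗ adjointCorep β) (Pi.single τ 1) σ =
      star (corepMatrix β (G.j σ) τ) := fun σ τ => by
    rw [LinearMap.comp_apply, J, LinearMap.funLeft_apply, ← corepMatrix_apply,
      corepMatrix_adjointCorep, Matrix.map_apply]
  constructor
  · intro h σ τ
    rw [← h1, h, h2, G.j_j]
  · intro h
    refine LinearMap.pi_ext' fun τ => LinearMap.ext_ring ?_
    funext σ
    exact (h1 σ τ).trans ((h2 σ τ).trans (by rw [← h, G.j_j])).symm

/-- The conjugate matrix is `u` with rows and columns permuted by `j`. -/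
theorem map_star_mem_unitary {u : Matrix E E A} (hu : u ∈ unitary (Matrix E E A))
    (h : ∀ σ τ, u (G.j σ) (G.j τ) = star (u σ τ)) : u.map star ∈ unitary (Matrix E E A) := by
  have hb : Function.Bijective G.j := (show Function.Involutive G.j from G.j_j).bijective
  refine Matrix.mem_unitary_of_row_col (fun σ σ' => ?_) fun τ τ' => ?_
  · have h1 := Matrix.unitary_row hu (G.j σ) (G.j σ')
    rw [← hb.sum_comp] at h1
    simpa only [h, G.j_injective.eq_iff, Matrix.map_apply] using h1
  · have h1 := Matrix.unitary_col hu (G.j τ) (G.j τ')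
    rw [← hb.sum_comp] at h1
    simpa only [h, G.j_injective.eq_iff, Matrix.map_apply] using h1

/-- Since `j` turns sources into targets and `u` into its conjugate, the source relation at reversed
edges is the target relation, with the same `q`. -/
theorem IsGraded.target [DecidableEq V] {u : Matrix E E A} {q : V → V → A}
    (hs : IsGraded G.s u q) (h : ∀ σ τ, u (G.j σ) (G.j τ) = star (u σ τ)) :
    IsGraded G.t (u.map star) q where
  surj v := by
    obtain ⟨σ, rfl⟩ := hs.surj v
    exact ⟨G.j σ, G.t_j σ⟩
  unitary := G.map_star_mem_unitary hs.unitary h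
  row_sum σ := by
    simp only [Matrix.map_apply]
    rw [← star_sum, hs.row_sum, star_one]
  mul_eq σ τ i := by
    have := hs.mul_eq (G.j σ) (G.j τ) i
    rwa [G.s_j, G.s_j, h] at this

end UndirectedMultigraph

/-! ## The underlying undirected multigraph -/

namespace Multigraph

variable {V E : Type*} (G : Multigraph V E) [Fintype E] [DecidableEq E] [DecidableEq V]
  {A : Type u} [CStarAlgebra A]

theorem corepMatrix_restrictL2 (γ : (G.UndirectedEdge → ℂ) →ₗ[ℂ] (G.UndirectedEdge → A)) :
    corepMatrix (G.restrictL2 γ) = (corepMatrix γ).toBlocks₁₁ := by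
  ext σ τ
  have : (Sum.elim (Pi.single τ 1) fun _ => 0 : G.UndirectedEdge → ℂ) =
      Pi.single (Sum.inl τ) 1 := by
    funext x
    rcases x with x | x <;> simp [Pi.single_apply]
  change γ (Sum.elim (Pi.single τ 1) fun _ => 0) (Sum.inl σ) = _
  rw [this]
  rfl

theorem leavesInvariant_iff {γ : (G.UndirectedEdge → ℂ) →ₗ[ℂ] (G.UndirectedEdge → A)} :
    G.LeavesInvariant γ ↔ ∀ σ τ, corepMatrix γ (Sum.inr σ) (Sum.inl τ) = 0 := by
  constructor
  · intro h σ τ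
    exact h (Pi.single (Sum.inl τ) 1) (fun ρ => by simp) σ
  · intro h f hf σ
    rw [apply_eq_sum_corepMatrix]
    simp [Fintype.sum_sum_type, h, hf]

theorem underlying_s_surjective (hG : G.NoIsolatedVertex) :
    Function.Surjective G.underlying.s := by
  intro v
  rcases hG v with ⟨τ, rfl⟩ | ⟨τ, rfl⟩
  · exact ⟨Sum.inl τ, rfl⟩
  · exact ⟨G.underlying.j (Sum.inl τ), G.underlying.s_j _⟩

theorem underlying_j_inl_of_ne {τ : E} (h : G.s τ ≠ G.t τ) :
    G.underlying.j (Sum.inl τ) = Sum.inr ⟨τ, h⟩ := dif_pos h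

theorem underlying_j_inl_of_eq {τ : E} (h : G.s τ = G.t τ) :
    G.underlying.j (Sum.inl τ) = Sum.inl τ := dif_neg (not_not.mpr h)

theorem underlying_j_inr (τ : {τ : E // G.s τ ≠ G.t τ}) :
    G.underlying.j (Sum.inr τ) = Sum.inl τ.1 := rfl

theorem src_eq_iff {τ : E} {i : G.Vs} : G.src τ = i ↔ G.s τ = i := Subtype.ext_iff

theorem tgt_eq_iff {τ : E} {i : G.Vt} : G.tgt τ = i ↔ G.t τ = i := Subtype.ext_iff

theorem src_surjective : Function.Surjective G.src := fun ⟨_, τ, h⟩ => ⟨τ, Subtype.ext h⟩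

theorem tgt_surjective : Function.Surjective G.tgt := fun ⟨_, τ, h⟩ => ⟨τ, Subtype.ext h⟩

theorem isInducedSource_coaction {Q : CompactQuantumGroup A} {β : (E → ℂ) →ₗ[ℂ] (E → A)}
    {q : G.Vs → G.Vs → A} (h : IsGraded G.src (corepMatrix β) q) (hc : IsCorepresentation Q β) :
    G.IsInducedSource Q β h.coaction := by
  refine ⟨h.isCoaction hc, fun i τ σ => ?_⟩
  rw [h.coaction_single, ← corepMatrix_apply, h.mul_eq]
  by_cases hi : i = G.src τ
  · rw [if_pos hi, if_pos hi.symm, corepMatrix_apply]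
  · rw [if_neg hi, if_neg (Ne.symm hi), map_zero, Pi.zero_apply]

theorem isInducedTarget_coaction {Q : CompactQuantumGroup A} {β : (E → ℂ) →ₗ[ℂ] (E → A)}
    {r : G.Vt → G.Vt → A} (h : IsGraded G.tgt ((corepMatrix β).map star) r)
    (hc : IsCorepresentation Q β) : G.IsInducedTarget Q β h.coaction := by
  refine ⟨h.isCoaction (comul_map_star hc), fun j τ σ => ?_⟩
  have h1 := congrArg star (h.mul_eq σ τ j)
  rw [star_mul, h.star_eq, Matrix.map_apply, star_star] at h1
  rw [h.coaction_single, ← corepMatrix_apply, h1]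
  split_ifs
  · rw [star_star, corepMatrix_apply]
  · rw [star_zero, map_zero, Pi.zero_apply]

/-- The restriction to `L²(E)` of a co-action on the underlying undirected multigraph preserving its
quantum symmetry preserves the quantum symmetry of the directed multigraph. -/
theorem preservesQuantumSymmetry_restrictL2 [Fintype V] (hG : G.NoIsolatedVertex)
    {Q : CompactQuantumGroup A} {βu : (G.UndirectedEdge → ℂ) →ₗ[ℂ] (G.UndirectedEdge → A)}
    (h : G.underlying.PreservesQuantumSymmetry Q βu) (hinv : G.LeavesInvariant βu) :
    G.PreservesQuantumSymmetry Q (G.restrictL2 βu) := by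
  have hrow := (map_one_eq_one_iff βu).mp h.fixed
  obtain ⟨q, hs⟩ := exists_isGraded (G.underlying_s_surjective hG) h.unitary hrow h.source
  have hj := G.underlying.inversion_iff.mp h.inversion
  have ht := UndirectedMultigraph.IsGraded.target G.underlying hs hj
  have ho := G.underlying.toMultigraph.restrictedOrthogonality_iff.mp h.ortho
  have hinv' := G.leavesInvariant_iff.mp hinv
  have hcor := h.corep
  unfold IsCorepresentation at hcor
  have hu := corepMatrix_restrictL2 G βu
  set W := corepMatrix βu with hW
  -- The other off-diagonal block vanishes too. For a loop `σ`, row orthogonality of `q` kills the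
  -- entry because the ends of `τ` differ; for a non-loop, reversal identifies the entry with the
  -- adjoint of one in the invariant block.
  have h12 : ∀ σ τ, W (Sum.inl σ) (Sum.inr τ) = 0 := fun σ τ => by
    by_cases hσ : G.s σ = G.t σ
    · refine hs.eq_zero ht ho ?_
      change q (G.s σ) (G.t τ) * q (G.t σ) (G.s τ) = 0
      rw [← hσ, hs.mul_row, if_neg (Ne.symm τ.2)]
    · have := hj (Sum.inr ⟨σ, hσ⟩) (Sum.inl τ)
      rw [hinv', star_zero, underlying_j_inr, G.underlying_j_inl_of_ne τ.2] at this
      exact this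
  set u := corepMatrix (G.restrictL2 βu) with hu'
  have hentry : ∀ σ τ, u σ τ = W (Sum.inl σ) (Sum.inl τ) := fun σ τ => by rw [hu]; rfl
  have hunit : u ∈ unitary (Matrix E E A) := by
    rw [hu]
    exact Matrix.toBlocks₁₁_mem_unitary hs.unitary h12 hinv'
  have hunit' : u.map star ∈ unitary (Matrix E E A) := by
    have h1 : u.map star = (W.map star).toBlocks₁₁ := by rw [hu]; rfl
    rw [h1]
    exact Matrix.toBlocks₁₁_mem_unitary ht.unitary
      (fun σ τ => by rw [Matrix.map_apply, h12, star_zero])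
      (fun σ τ => by rw [Matrix.map_apply, hinv', star_zero])
  have hurow : ∀ σ, ∑ τ, u σ τ = 1 := fun σ => by
    have := hrow (Sum.inl σ)
    rw [Fintype.sum_sum_type] at this
    simpa [h12, hentry] using this
  have hucol : ∀ τ, ∑ σ, u σ τ = 1 := Matrix.col_sum_of_unitary hunit hurow
  have hus : IsGraded G.src u fun k i => q k i :=
    ⟨G.src_surjective, hunit, hurow, fun σ τ i => by
      simp_rw [hentry, G.src_eq_iff]
      exact hs.mul_eq (Sum.inl σ) (Sum.inl τ) i⟩
  have hut : IsGraded G.tgt (u.map star) fun k i => q k i :=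
    ⟨G.tgt_surjective, hunit', fun σ => by
      simp only [Matrix.map_apply]
      rw [← star_sum, hurow, star_one], fun σ τ i => by
      simp_rw [Matrix.map_apply, hentry, G.tgt_eq_iff]
      exact ht.mul_eq (Sum.inl σ) (Sum.inl τ) i⟩
  -- Here `1` is written as a column sum of `u`. The column form of the grading keeps only edges
  -- with source `v`, of which there are none.
  have hqs : ∀ v τ, v ∉ G.Vs → q v (G.s τ) = 0 := fun v τ hv => by
    rw [← mul_one (q _ _), ← hucol τ, Finset.mul_sum]
    refine Finset.sum_eq_zero fun σ _ => ?_
    rw [hentry]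
    exact (hs.mul_eq_of_col (Sum.inl σ) (Sum.inl τ) v).trans (if_neg fun hσ => hv ⟨σ, hσ⟩)
  have hqt : ∀ v τ, v ∉ G.Vt → q v (G.t τ) = 0 := fun v τ hv => by
    rw [← mul_one (q _ _), ← star_one A, ← hucol τ, star_sum, Finset.mul_sum]
    refine Finset.sum_eq_zero fun σ _ => ?_
    rw [hentry]
    exact (ht.mul_eq_of_col (Sum.inl σ) (Sum.inl τ) v).trans (if_neg fun hσ => hv ⟨σ, hσ⟩)
  have hcorep : IsCorepresentation Q (G.restrictL2 βu) := fun σ τ => by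
    rw [← hu']
    simp_rw [hentry, hcor, Fintype.sum_sum_type, h12, MinTensor.zero_tmul,
      Finset.sum_const_zero, add_zero]
  refine ⟨hcorep, hunit, ?_, hus.Ad_mem, ?_, ?_, (map_one_eq_one_iff _).mpr hurow, ?_, ?_⟩
  · rw [IsUnitaryCorep, corepMatrix_adjointCorep]
    exact hunit'
  · rw [hu', ← corepMatrix_adjointCorep] at hut
    exact hut.Ad_mem
  · refine ⟨hus.coaction, hut.coaction, G.isInducedSource_coaction hus hcorep,
      G.isInducedTarget_coaction hut hcorep, fun f hf v hv => ?_, fun f hf v hv => ?_,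
      fun k v hks hkt hvs hvt => ?_⟩
    · rw [hus.coaction_apply]
      refine Finset.sum_eq_zero fun i _ => ?_
      by_cases hi : (i : V) ∈ G.Vt
      · obtain ⟨τ, hτ⟩ := hi
        rw [← hτ, hqt _ _ hv, smul_zero]
      · rw [hf i hi, zero_smul]
    · rw [hut.coaction_apply]
      refine Finset.sum_eq_zero fun i _ => ?_
      by_cases hi : (i : V) ∈ G.Vs
      · obtain ⟨τ, hτ⟩ := hi
        rw [← hτ, hqs _ _ hv, smul_zero]
      · rw [hf i hi, zero_smul]
    · rw [hus.coaction_single, hut.coaction_single]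
  · refine G.restrictedOrthogonality_iff.mpr fun σ σ' τ hs' ht' hne => ?_
    rw [← hu', hentry, hentry]
    exact ho _ _ _ hs' ht' (Sum.inl_injective.ne hne)
  · refine G.restrictedOrthogonality_iff.mpr fun σ σ' τ hs' ht' hne => ?_
    -- Conjugate entries are entries of `W` at reversed edges, and reversing parallel edges gives
    -- parallel edges, so the hypothesis on `W` applies.
    rw [corepMatrix_adjointCorep, ← hu', Matrix.map_apply, Matrix.map_apply, hentry, hentry,
      ← hj, ← hj]
    refine ho _ _ _ ?_ ?_ (G.underlying.j_injective.ne (Sum.inl_injective.ne hne))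
    · rw [G.underlying.s_j, G.underlying.s_j]
      exact ht'
    · rw [G.underlying.t_j, G.underlying.t_j]
      exact hs'

end Multigraph

/-! ## Extension to the underlying undirected multigraph -/

section Support

variable {A : Type u} [CStarAlgebra A] {X K : Type*} [Fintype X] [DecidableEq X] [DecidableEq K]
  [Fintype K]

/-- If the magic unitary `q` is block triangular with respect to `P`, then it is block diagonal. -/
theorem IsGraded.eq_zero_of_triangular {φ : X → K} {u : Matrix X X A} {q : K → K → A}
    (h : IsGraded φ u q) {P : K → Prop} (hP : ∀ k i, ¬P k → P i → q k i = 0) {k i : K}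
    (hk : P k) (hi : ¬P i) : q k i = 0 := by
  classical
  -- Both sides count the indices in `P`: the left by full column sums, since entries outside `P`
  -- vanish there, the right by row sums. The projections in the remaining block therefore sum to
  -- zero.
  have h1 : ∑ k with P k, ∑ i with P i, q k i = ∑ k with P k, ∑ i, q k i := by
    rw [Finset.sum_comm]
    refine Finset.sum_congr rfl fun i hi => ?_
    rw [h.row_sum_eq_one, ← h.col_sum_eq_one i]
    exact Finset.sum_subset (Finset.filter_subset _ _) fun k _ hk =>
      hP k i (by simpa using hk) (by simpa using hi)
  have h2 : ∑ p ∈ (Finset.univ.filter P) ×ˢ (Finset.univ.filter fun i => ¬P i),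
      star (q p.1 p.2) * q p.1 p.2 = 0 := by
    simp_rw [h.star_mul_self]
    rw [Finset.sum_product]
    have h3 : ∀ k, ∑ i, q k i = (∑ i with P i, q k i) + ∑ i with ¬P i, q k i := fun k =>
      (Finset.sum_filter_add_sum_filter_not _ _ _).symm
    simp_rw [h3] at h1
    rw [Finset.sum_add_distrib] at h1
    exact left_eq_add.mp h1
  exact eq_zero_of_sum_star_mul_self (x := fun p : K × K => q p.1 p.2) h2
    (i := (k, i)) (by simp [hk, hi])

end Support

/-! ### The block matrix of `u` and its conjugate -/

namespace Multigraph

variable {V E : Type*} (G : Multigraph V E) [Fintype E] [DecidableEq E] [DecidableEq V]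
  {A : Type u} [CStarAlgebra A]

theorem sum_nonloop {B : Type*} [AddCommMonoid B] {f : E → B}
    (h : ∀ τ, G.s τ = G.t τ → f τ = 0) :
    ∑ τ : {τ : E // G.s τ ≠ G.t τ}, f τ = ∑ τ, f τ := by
  rw [← Finset.sum_subtype (Finset.univ.filter fun τ => G.s τ ≠ G.t τ) (by simp) f,
    Finset.sum_filter]
  refine Finset.sum_congr rfl fun τ _ => ?_
  split_ifs with hτ
  · rfl
  · exact (h τ (not_not.mp hτ)).symm

/-- The matrix on the underlying undirected multigraph which is `u` on the edges of `G` and its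
conjugate on the new edges. -/
def undirectedMatrix (u : Matrix E E A) : Matrix G.UndirectedEdge G.UndirectedEdge A :=
  Matrix.fromBlocks u 0 0 ((u.map star).submatrix Subtype.val Subtype.val)

/-- As `u` does not mix loops with non-loops, dropping the loops from the conjugate matrix loses no
nonzero term in the relations between non-loops. -/
theorem undirectedMatrix_mem_unitary {u : Matrix E E A} (hu : u ∈ unitary (Matrix E E A))
    (hu' : u.map star ∈ unitary (Matrix E E A))
    (h : ∀ σ τ, ¬(G.s σ = G.t σ ↔ G.s τ = G.t τ) → u σ τ = 0) :
    G.undirectedMatrix u ∈ unitary (Matrix G.UndirectedEdge G.UndirectedEdge A) := by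
  refine Matrix.mem_unitary_of_row_col ?_ ?_
  · rintro (σ | σ) (σ' | σ')
    · simpa [undirectedMatrix, Fintype.sum_sum_type] using Matrix.unitary_row hu σ σ'
    · simp [undirectedMatrix, Fintype.sum_sum_type]
    · simp [undirectedMatrix, Fintype.sum_sum_type]
    · have h1 := Matrix.unitary_row hu' σ σ'
      rw [← G.sum_nonloop fun τ hτ => by simp [h σ τ (by simp [σ.2, hτ])]] at h1
      simpa [undirectedMatrix, Fintype.sum_sum_type, Subtype.ext_iff] using h1
  · rintro (τ | τ) (τ' | τ')
    · simpa [undirectedMatrix, Fintype.sum_sum_type] using Matrix.unitary_col hu τ τ'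
    · simp [undirectedMatrix, Fintype.sum_sum_type]
    · simp [undirectedMatrix, Fintype.sum_sum_type]
    · have h1 := Matrix.unitary_col hu' τ τ'
      rw [← G.sum_nonloop fun σ hσ => by simp [h σ τ (by simp [τ.2, hσ])]] at h1
      simpa [undirectedMatrix, Fintype.sum_sum_type, Subtype.ext_iff] using h1

/-- Reversal exchanges the two blocks on non-loops but fixes loops, which is why self-adjoint
entries are needed between loops. -/
theorem undirectedMatrix_j {u : Matrix E E A}
    (h : ∀ σ τ, ¬(G.s σ = G.t σ ↔ G.s τ = G.t τ) → u σ τ = 0)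
    (hl : ∀ σ τ, G.s σ = G.t σ → G.s τ = G.t τ → star (u σ τ) = u σ τ)
    (σ τ : G.UndirectedEdge) :
    G.undirectedMatrix u (G.underlying.j σ) (G.underlying.j τ) =
      star (G.undirectedMatrix u σ τ) := by
  rcases σ with σ | σ <;> rcases τ with τ | τ
  · by_cases hσ : G.s σ = G.t σ <;> by_cases hτ : G.s τ = G.t τ
    · rw [G.underlying_j_inl_of_eq hσ, G.underlying_j_inl_of_eq hτ]
      exact (hl σ τ hσ hτ).symm
    · rw [G.underlying_j_inl_of_eq hσ, G.underlying_j_inl_of_ne hτ]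
      simp [undirectedMatrix, h σ τ (by simp [hσ, hτ])]
    · rw [G.underlying_j_inl_of_ne hσ, G.underlying_j_inl_of_eq hτ]
      simp [undirectedMatrix, h σ τ (by simp [hσ, hτ])]
    · rw [G.underlying_j_inl_of_ne hσ, G.underlying_j_inl_of_ne hτ]
      rfl
  · by_cases hσ : G.s σ = G.t σ
    · rw [G.underlying_j_inl_of_eq hσ, underlying_j_inr]
      simp [undirectedMatrix, h σ τ (by simp [hσ, τ.2])]
    · rw [G.underlying_j_inl_of_ne hσ, underlying_j_inr]
      simp [undirectedMatrix]
  · by_cases hτ : G.s τ = G.t τ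
    · rw [G.underlying_j_inl_of_eq hτ, underlying_j_inr]
      simp [undirectedMatrix, h σ τ (by simp [σ.2, hτ])]
    · rw [G.underlying_j_inl_of_ne hτ, underlying_j_inr]
      simp [undirectedMatrix]
  · rw [underlying_j_inr, underlying_j_inr]
    simp [undirectedMatrix]

theorem comul_undirectedMatrix {u : Matrix E E A} {Δ : A →⋆ₐ[ℂ] MinTensor A A}
    (hΔ : ∀ x y, Δ (u x y) = ∑ z, MinTensor.tmul (u x z) (u z y))
    (h : ∀ σ τ, ¬(G.s σ = G.t σ ↔ G.s τ = G.t τ) → u σ τ = 0) (σ τ : G.UndirectedEdge) :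
    Δ (G.undirectedMatrix u σ τ) =
      ∑ ρ, MinTensor.tmul (G.undirectedMatrix u σ ρ) (G.undirectedMatrix u ρ τ) := by
  rcases σ with σ | σ <;> rcases τ with τ | τ
  · simp [undirectedMatrix, Fintype.sum_sum_type, hΔ, MinTensor.zero_tmul]
  · simp [undirectedMatrix, Fintype.sum_sum_type, MinTensor.zero_tmul, MinTensor.tmul_zero]
  · simp [undirectedMatrix, Fintype.sum_sum_type, MinTensor.zero_tmul, MinTensor.tmul_zero]
  · have h1 := comul_map_star hΔ σ τ
    rw [← G.sum_nonloop fun ρ hρ => by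
      simp [h σ ρ (by simp [σ.2, hρ]), MinTensor.zero_tmul]] at h1
    simpa [undirectedMatrix, Fintype.sum_sum_type, MinTensor.zero_tmul] using h1

theorem isGraded_source {Q : CompactQuantumGroup A} {β : (E → ℂ) →ₗ[ℂ] (E → A)}
    {αs : (G.Vs → ℂ) →⋆ₐ[ℂ] (G.Vs → A)} (h : G.IsInducedSource Q β αs)
    (hu : IsUnitaryCorep β) (h1 : ∀ σ, ∑ τ, corepMatrix β σ τ = 1) :
    IsGraded G.src (corepMatrix β) fun k i => αs (Pi.single i 1) k :=
  ⟨G.src_surjective, hu, h1, fun σ τ i => by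
    rw [corepMatrix_apply, h.2]
    by_cases hi : i = G.src τ
    · rw [if_pos hi, if_pos hi.symm]
    · rw [if_neg hi, if_neg (Ne.symm hi), map_zero, Pi.zero_apply]⟩

theorem isGraded_target {Q : CompactQuantumGroup A} {β : (E → ℂ) →ₗ[ℂ] (E → A)}
    {αt : (G.Vt → ℂ) →⋆ₐ[ℂ] (G.Vt → A)} (h : G.IsInducedTarget Q β αt)
    (hu : IsUnitaryCorep (adjointCorep β)) (h1 : ∀ σ, ∑ τ, corepMatrix β σ τ = 1) :
    IsGraded G.tgt ((corepMatrix β).map star) fun k i => αt (Pi.single i 1) k := by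
  rw [IsUnitaryCorep, corepMatrix_adjointCorep] at hu
  refine ⟨G.tgt_surjective, hu, fun σ => ?_, fun σ τ i => ?_⟩
  · simp only [Matrix.map_apply]
    rw [← star_sum, h1, star_one]
  · have h2 : star (αt (Pi.single i 1) (G.tgt σ)) = αt (Pi.single i 1) (G.tgt σ) := by
      rw [← Pi.star_apply, ← map_star, ← Pi.single_star, star_one]
    rw [Matrix.map_apply, ← h2, ← star_mul, corepMatrix_apply, h.2]
    by_cases hi : G.tgt τ = i
    · rw [if_pos hi, if_pos hi]
    · rw [if_neg hi, if_neg hi, map_zero, Pi.zero_apply, star_zero]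

/-- A co-action on a directed multigraph preserving its quantum symmetry extends to the underlying
undirected multigraph. -/
theorem exists_preservesQuantumSymmetry_underlying [Fintype V]
    {Q : CompactQuantumGroup A} {β : (E → ℂ) →ₗ[ℂ] (E → A)}
    (h : G.PreservesQuantumSymmetry Q β) :
    ∃ βu : (G.UndirectedEdge → ℂ) →ₗ[ℂ] (G.UndirectedEdge → A),
      G.underlying.PreservesQuantumSymmetry Q βu ∧
        G.LeavesInvariant βu ∧ G.restrictL2 βu = β := by
  have hrow := (map_one_eq_one_iff β).mp h.fixed
  obtain ⟨αs, αt, hαs, hαt, hps, hpt, hst⟩ := h.induced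
  have hs := G.isGraded_source hαs h.unitary hrow
  have ht := G.isGraded_target hαt h.unitary_adjoint hrow
  have ho := G.restrictedOrthogonality_iff.mp h.ortho
  have ho' := G.restrictedOrthogonality_iff.mp h.ortho_adjoint
  rw [corepMatrix_adjointCorep] at ho'
  have hcor : ∀ x y, _ := h.corep
  set u := corepMatrix β
  have hoG : ∀ σ σ' τ, G.src σ = G.src σ' → G.tgt σ = G.tgt σ' → σ ≠ σ' →
      u σ τ * star (u σ' τ) = 0 := fun σ σ' τ h1 h2 =>
    ho σ σ' τ (congrArg Subtype.val h1) (congrArg Subtype.val h2)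
  set q : G.Vs → G.Vs → A := fun k i => αs (Pi.single i 1) k
  set r : G.Vt → G.Vt → A := fun k i => αt (Pi.single i 1) k
  have hqr : ∀ (k v : V) (hks : k ∈ G.Vs) (hkt : k ∈ G.Vt) (hvs : v ∈ G.Vs) (hvt : v ∈ G.Vt),
      q ⟨k, hks⟩ ⟨v, hvs⟩ = r ⟨k, hkt⟩ ⟨v, hvt⟩ := fun k v hks hkt hvs hvt =>
    hst v k hvs hvt hks hkt
  -- Preservation of functions on the common vertices gives one vanishing block of `q` and of `r`;
  -- triangularity of a magic unitary then gives the opposite block.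
  have hq0 : ∀ k i : G.Vs, (k : V) ∉ G.Vt → (i : V) ∈ G.Vt → q k i = 0 := fun k i hk hi =>
    hps _ (fun v hv => Pi.single_eq_of_ne (by rintro rfl; exact hv hi) _) k hk
  have hr0 : ∀ k i : G.Vt, (k : V) ∉ G.Vs → (i : V) ∈ G.Vs → r k i = 0 := fun k i hk hi =>
    hpt _ (fun v hv => Pi.single_eq_of_ne (by rintro rfl; exact hv hi) _) k hk
  have hq1 : ∀ k i : G.Vs, (k : V) ∈ G.Vt → (i : V) ∉ G.Vt → q k i = 0 := fun k i hk hi =>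
    hs.eq_zero_of_triangular (P := fun k => (k : V) ∈ G.Vt) hq0 hk hi
  have hr1 : ∀ k i : G.Vt, (k : V) ∈ G.Vs → (i : V) ∉ G.Vs → r k i = 0 := fun k i hk hi =>
    ht.eq_zero_of_triangular (P := fun k => (k : V) ∈ G.Vs) hr0 hk hi
  -- It suffices that the product of `q` and `r` vanishes. If the ends of the non-loop are common
  -- vertices, `r` is replaced by `q` and the factors are distinct entries of one column (when `τ`
  -- is the loop) or one row (when `σ` is). Otherwise a factor lies in a zero block.
  have hloop : ∀ σ τ, ¬(G.s σ = G.t σ ↔ G.s τ = G.t τ) → u σ τ = 0 := fun σ τ hne => by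
    refine hs.eq_zero ht hoG ?_
    by_cases hτ : G.s τ = G.t τ
    · have hσ : G.s σ ≠ G.t σ := fun hσ => hne (by simp [hσ, hτ])
      by_cases h1 : G.s σ ∈ G.Vt
      · by_cases h2 : G.t σ ∈ G.Vs
        · have h3 : r (G.tgt σ) (G.tgt τ) = q ⟨G.t σ, h2⟩ (G.src τ) := by
            rw [show G.src τ = ⟨G.t τ, hτ ▸ (G.src τ).2⟩ from Subtype.ext hτ]
            exact (hqr _ _ _ _ _ _).symm
          rw [h3, hs.mul_col]
          exact fun h4 => hσ (congrArg Subtype.val h4)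
        · rw [hr0 _ _ h2 ⟨τ, hτ⟩, mul_zero]
      · rw [hq0 _ _ h1 ⟨τ, hτ.symm⟩, zero_mul]
    · have hσ : G.s σ = G.t σ := by
        by_contra hσ
        exact hne (by simp [hσ, hτ])
      by_cases h1 : G.s τ ∈ G.Vt
      · by_cases h2 : G.t τ ∈ G.Vs
        · have h3 : r (G.tgt σ) (G.tgt τ) = q (G.src σ) ⟨G.t τ, h2⟩ := by
            rw [show G.src σ = ⟨G.t σ, hσ ▸ (G.src σ).2⟩ from Subtype.ext hσ]
            exact (hqr _ _ _ _ _ _).symm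
          rw [h3, hs.mul_row, if_neg fun h4 => hτ (congrArg Subtype.val h4)]
        · rw [hr1 _ _ ⟨σ, hσ⟩ h2, mul_zero]
      · rw [hq1 _ _ ⟨σ, hσ.symm⟩ h1, zero_mul]
  -- Between loops the two projections coincide and fix `star (u σ τ)`. The cut-off identity becomes
  -- `star (u σ τ) = u σ τ * star (u σ τ)`, which is self-adjoint.
  have hself : ∀ σ τ, G.s σ = G.t σ → G.s τ = G.t τ → star (u σ τ) = u σ τ := fun σ τ hσ hτ => by
    have h1 : q (G.src σ) (G.src τ) = r (G.tgt σ) (G.tgt τ) := by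
      rw [show G.src τ = ⟨G.t τ, hτ ▸ (G.src τ).2⟩ from Subtype.ext hτ,
        show G.src σ = ⟨G.t σ, hσ ▸ (G.src σ).2⟩ from Subtype.ext hσ]
      exact hqr _ _ _ _ _ _
    have h2 := hs.mul_star_self_eq ht hoG σ τ
    have h3 := ht.mul_eq σ τ (G.tgt τ)
    rw [if_pos rfl, Matrix.map_apply] at h3
    rw [mul_assoc, h3, h1, h3] at h2
    have h4 := congrArg star h2
    rw [star_mul, star_star] at h4
    rw [h2]
    exact h4.symm
  have hunit := G.undirectedMatrix_mem_unitary hs.unitary ht.unitary hloop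
  -- At a common vertex the two co-actions agree on restrictions of any function on `V`, since both
  -- sums are supported on common vertices.
  have hsum : ∀ (f : V → ℂ) (v : V) (hvs : v ∈ G.Vs) (hvt : v ∈ G.Vt),
      ∑ i : G.Vs, f i • q ⟨v, hvs⟩ i = ∑ i : G.Vt, f i • r ⟨v, hvt⟩ i := by
    intro f v hvs hvt
    refine Finset.sum_bij_ne_zero (fun i _ hi => ⟨i, ?_⟩) ?_ ?_ ?_ ?_
    · by_contra hi'
      exact hi (by rw [hq1 _ _ hvt hi', smul_zero])
    · simp
    · intro i _ _ i' _ _ hii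
      exact Subtype.ext (congrArg (fun x : G.Vt => (x : V)) hii)
    · intro i _ hi
      have hi' : (i : V) ∈ G.Vs := by
        by_contra hi'
        exact hi (by rw [hr1 _ _ hvs hi', smul_zero])
      refine ⟨⟨i, hi'⟩, Finset.mem_univ _, ?_, rfl⟩
      rwa [hqr _ _ _ hvt hi' i.2]
    · intro i _ hi
      rw [← hqr]
  refine ⟨corepOfMatrix (G.undirectedMatrix u), ⟨?_, ?_, fun f => ?_, ?_, ?_, ?_⟩, ?_, ?_⟩
  · intro σ τ
    rw [corepMatrix_corepOfMatrix]
    exact G.comul_undirectedMatrix hcor hloop σ τ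
  · rw [IsUnitaryCorep, corepMatrix_corepOfMatrix]
    exact hunit
  · classical
    obtain ⟨g, h1⟩ : ∃ g : V → A, Ad (corepOfMatrix (G.undirectedMatrix u)) (G.underlying.S f) =
        Matrix.diagonal fun σ => g (G.underlying.s σ) := by
      -- New edges have their source in `V^t`, old ones in `V^s`. The values of the two co-actions
      -- are glued with preference for `αs`; `hsum` makes the choice harmless at common vertices,
      -- and the final `0` is never met at the source of an edge.
      refine ⟨fun v => if hv : v ∈ G.Vs then ∑ i : G.Vs, f i • q ⟨v, hv⟩ i
        else if hv : v ∈ G.Vt then ∑ i : G.Vt, f i • r ⟨v, hv⟩ i else 0, ?_⟩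
      ext σ σ'
      change Ad _ (Matrix.diagonal fun x => f (G.underlying.s x)) σ σ' = _
      rw [Ad_diagonal_apply, corepMatrix_corepOfMatrix, Matrix.diagonal_apply,
        Fintype.sum_sum_type]
      rcases σ with σ | σ <;> rcases σ' with σ' | σ'
      · have h2 := hs.sum_smul_mul_star (fun v => f v) σ σ'
        have h3 : G.s σ ∈ G.Vs := ⟨σ, rfl⟩
        simpa [undirectedMatrix, underlying, h3, src] using h2
      · simp [undirectedMatrix]
      · simp [undirectedMatrix]
      · have h2 := ht.sum_smul_mul_star (fun v => f v) σ σ'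
        have h3 : G.t σ ∈ G.Vt := ⟨σ, rfl⟩
        rw [← G.sum_nonloop fun τ hτ => by simp [hloop σ τ (by simp [σ.2, hτ])]] at h2
        have h4 : (if hv : G.t σ ∈ G.Vs then ∑ i : G.Vs, f i • q ⟨G.t σ, hv⟩ i
          else if hv : G.t σ ∈ G.Vt then ∑ i : G.Vt, f i • r ⟨G.t σ, hv⟩ i else 0) =
            ∑ i : G.Vt, f i • r (G.tgt σ) i := by
          split_ifs with h5
          · exact hsum f _ h5 h3
          · rfl
        have h5 : G.underlying.s (Sum.inr σ) = G.t σ := rfl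
        simp only [h5, h4]
        simpa [undirectedMatrix, underlying, Subtype.ext_iff, tgt] using h2
    rw [h1]
    exact diagonal_comp_mem_tensorSubspace G.underlying.s g
  · refine G.underlying.inversion_iff.mpr fun σ τ => ?_
    rw [corepMatrix_corepOfMatrix]
    exact G.undirectedMatrix_j hloop hself σ τ
  · rw [map_one_eq_one_iff, corepMatrix_corepOfMatrix]
    rintro (σ | σ)
    · simpa [undirectedMatrix, Fintype.sum_sum_type] using hrow σ
    · have h2 := ht.row_sum σ
      rw [← G.sum_nonloop fun τ hτ => by simp [hloop σ τ (by simp [σ.2, hτ])]] at h2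
      simpa [undirectedMatrix, Fintype.sum_sum_type] using h2
  · refine G.underlying.restrictedOrthogonality_iff.mpr fun σ σ' τ h1 h2 hne => ?_
    rw [corepMatrix_corepOfMatrix]
    rcases τ with τ | τ
    · rcases σ with σ | σ
      · rcases σ' with σ' | σ'
        · exact ho σ σ' τ h1 h2 fun h3 => hne (congrArg _ h3)
        · simp [undirectedMatrix]
      · simp [undirectedMatrix]
    · rcases σ with σ | σ
      · simp [undirectedMatrix]
      · rcases σ' with σ' | σ'
        · simp [undirectedMatrix]
        · exact ho' σ σ' τ h2 h1 fun h3 => hne (congrArg _ (Subtype.ext h3))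
  · rw [leavesInvariant_iff, corepMatrix_corepOfMatrix]
    exact fun σ τ => rfl
  · refine corepMatrix_injective ?_
    rw [corepMatrix_restrictL2, corepMatrix_corepOfMatrix]
    exact Matrix.toBlocks_fromBlocks₁₁ _ _ _ _

end Multigraph

end

theorem mainTheorem10 {V E : Type*} [Fintype V] [DecidableEq V] [Fintype E] [DecidableEq E]
    (G : Multigraph V E) (hG : G.NoIsolatedVertex)
    {A : Type u} [CStarAlgebra A] (Q : CompactQuantumGroup A) :
    (∀ β : (E → ℂ) →ₗ[ℂ] (E → A), G.PreservesQuantumSymmetry Q β →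
      ∃ βu : (G.UndirectedEdge → ℂ) →ₗ[ℂ] (G.UndirectedEdge → A),
        G.underlying.PreservesQuantumSymmetry Q βu ∧
        G.LeavesInvariant βu ∧ G.restrictL2 βu = β) ∧
    (∀ βu : (G.UndirectedEdge → ℂ) →ₗ[ℂ] (G.UndirectedEdge → A),
      G.underlying.PreservesQuantumSymmetry Q βu → G.LeavesInvariant βu →
        G.PreservesQuantumSymmetry Q (G.restrictL2 βu)) :=
  ⟨fun _ hβ => G.exists_preservesQuantumSymmetry_underlying hβ,
    fun _ hβu hinv => G.preservesQuantumSymmetry_restrictL2 hG hβu hinv⟩
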